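/- Let $n\ge 0$ and let $(S,g)$ be a Sasaki manifold of dimension $2n+1$: a smooth Riemannian manifold whose metric cone $(C(S),\bar g)=(\mathbb{R}_{>0}\times S,\;dr^2+r^2g)$ is Kähler for a complex structure $J$ on $C(S)$. Fix such a $J$. Let $\omega(X,Y)=\bar g(JX,Y)$ be the Kähler form, let $\xi=J(r\frac{\partial}{\partial r})$ and $\eta(X)=r^{-2}\bar g(\xi,X)$, and identify $S$ with the hypersurface $\{r=1\}\subset C(S)$. Suppose that $\tau:C(S)\to C(S)$ is an anti-holomorphic involution, i.e. a diffeomorphism with $\tau^2=\mathrm{id}$ and $\tau_*\circ J=-J\circ\tau_*$, such that $\tau^*r=r$ and the fixed point set $\mathrm{fix}(\tau)$ is not empty. Then: (i) $\mathrm{fix}(\tau)$ is a Lagrangian cone in $C(S)$: it is an embedded submanifold of dimension $n+1$ on which $\omega$ vanishes, and it is invariant under $(r,x)\mapsto(ar,x)$ for every $a>0$; (ii) the link $\mathrm{fix}(\tau)\cap S$ is a nonempty totally geodesic Legendrian submanifold of $S$: it is an embedded submanifold of dimension $n$ on which $\eta$ vanishes, and its second fundamental form in $(S,g)$ is zero.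 -/

import Mathlib

open Set Filter Bundle TopologicalSpace
open scoped Manifold ContDiff Topology

noncomputable section

/-! ## Submanifolds, almost complex structures and Kähler structures -/

section General

variable {E : Type*} [NormedAddCommGroup E] [NormedSpace ℝ E]
  {H : Type*} [TopologicalSpace H] (I : ModelWithCorners ℝ E H)
  {M : Type*} [TopologicalSpace M] [ChartedSpace H M]

/-- `A` is a (smooth, embedded) `k`-dimensional submanifold of the boundaryless manifold `M`:
around each of its points there is a smooth chart of `M` in which `A` is a `k`-dimensional linear
subspace. -/
def IsSubmanifold (k : ℕ) (A : Set M) : Prop :=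
  ∀ p ∈ A, ∃ φ ∈ IsManifold.maximalAtlas I ∞ M, p ∈ φ.source ∧
    ∃ V : Submodule ℝ E, Module.finrank ℝ V = k ∧
      ∀ q ∈ φ.source, (q ∈ A ↔ φ.extend I q ∈ V)

/-- The vectors at `p` tangent to the subset `A`: the velocities at time `0` of the smooth curves
which run inside `A` and pass through `p` at time `0`. When `A` is a submanifold
and `p ∈ A`, this is the tangent space of `A` at `p`. -/
def tangentVectors (A : Set M) (p : M) : Set (TangentSpace I p) :=
  {v | ∃ γ : ℝ → M, ContMDiffAt 𝓘(ℝ, ℝ) I ∞ γ 0 ∧ (∀ᶠ t in 𝓝 (0 : ℝ), γ t ∈ A) ∧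
    tangentMap 𝓘(ℝ, ℝ) I γ ⟨0, (1 : ℝ)⟩ = (⟨p, v⟩ : TangentBundle I M)}

/-- The vector field `X` is smooth at `p`. -/
def SmoothFieldAt [IsManifold I ∞ M] (X : ∀ q : M, TangentSpace I q) (p : M) : Prop :=
  ContMDiffAt I I.tangent ∞ (fun q ↦ (⟨q, X q⟩ : TangentBundle I M)) p

/-- `J` is a complex structure on `M`: a smooth field of endomorphisms of the tangent spaces with
`J² = -1` whose Nijenhuis tensor
`[JX, JY] - [X, Y] - J[X, JY] - J[JX, Y]` vanishes. -/
structure IsComplexStructure [IsManifold I ∞ M]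
    (J : ∀ p : M, TangentSpace I p →L[ℝ] TangentSpace I p) : Prop where
  smooth : ContMDiff I (I.prod 𝓘(ℝ, E →L[ℝ] E)) ∞ (fun p ↦
    TotalSpace.mk' (E →L[ℝ] E)
      (E := fun q : M ↦ TangentSpace I q →L[ℝ] TangentSpace I q) p (J p))
  sq_eq_neg : ∀ (p : M) (v : TangentSpace I p), J p (J p v) = -v
  integrable : ∀ (p : M) (X Y : ∀ q : M, TangentSpace I q),
    SmoothFieldAt I X p → SmoothFieldAt I Y p →
      VectorField.mlieBracket I (fun q ↦ J q (X q)) (fun q ↦ J q (Y q)) p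
        - VectorField.mlieBracket I X Y p
        - J p (VectorField.mlieBracket I X (fun q ↦ J q (Y q)) p)
        - J p (VectorField.mlieBracket I (fun q ↦ J q (X q)) Y p) = 0

/-- The fundamental form `ω(u, v) = h(Ju, v)` of the metric `h` and of `J`. -/
def fundamentalForm (h : ∀ p : M, TangentSpace I p → TangentSpace I p → ℝ)
    (J : ∀ p : M, TangentSpace I p →L[ℝ] TangentSpace I p) (p : M)
    (u v : TangentSpace I p) : ℝ :=
  h p (J p u) v

/-- The derivative `X f` at `p` of the function `f` in the direction of the vector `v`. -/
def dirDeriv (f : M → ℝ) (p : M) (v : TangentSpace I p) : ℝ :=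
  mfderiv I 𝓘(ℝ, ℝ) f p v

/-- The 2-form `σ` is closed: `dσ(X, Y, Z) = 0` for all vector fields. -/
def IsClosedTwoForm [IsManifold I ∞ M]
    (σ : ∀ p : M, TangentSpace I p → TangentSpace I p → ℝ) : Prop :=
  ∀ (p : M) (X Y Z : ∀ q : M, TangentSpace I q),
    SmoothFieldAt I X p → SmoothFieldAt I Y p → SmoothFieldAt I Z p →
      dirDeriv I (fun q ↦ σ q (Y q) (Z q)) p (X p)
        + dirDeriv I (fun q ↦ σ q (Z q) (X q)) p (Y p)
        + dirDeriv I (fun q ↦ σ q (X q) (Y q)) p (Z p)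
        - σ p (VectorField.mlieBracket I X Y p) (Z p)
        - σ p (VectorField.mlieBracket I Y Z p) (X p)
        - σ p (VectorField.mlieBracket I Z X p) (Y p) = 0

/-- The Riemannian metric `h` is Kähler for the complex structure `J`. -/
structure IsKahler [IsManifold I ∞ M]
    (h : ∀ p : M, TangentSpace I p → TangentSpace I p → ℝ)
    (J : ∀ p : M, TangentSpace I p →L[ℝ] TangentSpace I p) : Prop where
  complex : IsComplexStructure I J
  hermitian : ∀ (p : M) (u v : TangentSpace I p), h p (J p u) (J p v) = h p u v
  closed : IsClosedTwoForm I (fundamentalForm I h J)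

/-- `A` is a Lagrangian submanifold for the Kähler structure `(h, J)`: a submanifold of half the
dimension on which the Kähler form vanishes. -/
def IsLagrangian (h : ∀ p : M, TangentSpace I p → TangentSpace I p → ℝ)
    (J : ∀ p : M, TangentSpace I p →L[ℝ] TangentSpace I p) (A : Set M) : Prop :=
  (∃ k : ℕ, Module.finrank ℝ E = 2 * k ∧ IsSubmanifold I k A) ∧
    ∀ p ∈ A, ∀ u ∈ tangentVectors I A p, ∀ v ∈ tangentVectors I A p,
      fundamentalForm I h J p u v = 0

/-- `w = (∇_X Y)(p)` for the Levi-Civita connection `∇` of the Riemannian metric `g`, expressed by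
the Koszul formula. -/
def IsLeviCivitaDerivAt [IsManifold I ∞ M]
    (g : ∀ p : M, TangentSpace I p → TangentSpace I p → ℝ)
    (X Y : ∀ q : M, TangentSpace I q) (p : M) (w : TangentSpace I p) : Prop :=
  ∀ Z : ∀ q : M, TangentSpace I q, SmoothFieldAt I Z p →
    2 * g p w (Z p) =
      dirDeriv I (fun q ↦ g q (Y q) (Z q)) p (X p)
        + dirDeriv I (fun q ↦ g q (Z q) (X q)) p (Y p)
        - dirDeriv I (fun q ↦ g q (X q) (Y q)) p (Z p)
        + g p (VectorField.mlieBracket I X Y p) (Z p)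
        - g p (VectorField.mlieBracket I Y Z p) (X p)
        + g p (VectorField.mlieBracket I Z X p) (Y p)

/-- The submanifold `L` is totally geodesic for the Riemannian metric `g`: its second fundamental
form vanishes, that is, `∇_X Y` is tangent to `L` along `L` whenever `X` and `Y` are
tangent to `L` along `L`. -/
def IsTotallyGeodesic [IsManifold I ∞ M]
    (g : ∀ p : M, TangentSpace I p → TangentSpace I p → ℝ)
    (L : Set M) : Prop :=
  ∀ p ∈ L, ∀ X Y : ∀ q : M, TangentSpace I q, SmoothFieldAt I X p → SmoothFieldAt I Y p →
    (∀ᶠ q in 𝓝 p, q ∈ L → X q ∈ tangentVectors I L q ∧ Y q ∈ tangentVectors I L q) →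
      ∃ w ∈ tangentVectors I L p, IsLeviCivitaDerivAt I g X Y p w

/-- `τ` is an anti-holomorphic involution of `M` with its complex structure `J`. -/
structure IsAntiholomorphicInvolution
    (J : ∀ p : M, TangentSpace I p →L[ℝ] TangentSpace I p) (τ : M ≃ₘ^∞⟮I, I⟯ M) : Prop where
  involutive : ∀ p : M, τ (τ p) = p
  antiholomorphic : ∀ (p : M) (v : TangentSpace I p),
    mfderiv I I τ p (J p v) = -J (τ p) (mfderiv I I τ p v)

end General

/-! ## The metric cone of a Riemannian manifold and Sasaki manifolds -/

/-- The half-line `ℝ_{>0}`, as an open subset of `ℝ`. -/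
def posReal : Opens ℝ := ⟨Ioi 0, isOpen_Ioi⟩

/-- The cone `C(S) = ℝ_{>0} × S`, with its structure of product manifold. -/
abbrev Cone (S : Type*) : Type _ := posReal × S

/-- The model with corners of a manifold of dimension `2n+1`. -/
abbrev baseModel (n : ℕ) := 𝓡 (2 * n + 1)

/-- The model with corners of the cone over a manifold of dimension `2n+1`. -/
abbrev coneModel (n : ℕ) := 𝓘(ℝ, ℝ).prod (baseModel n)

section Cone

variable {n : ℕ} {S : Type*} [TopologicalSpace S]
  [ChartedSpace (EuclideanSpace ℝ (Fin (2 * n + 1))) S] [IsManifold (baseModel n) ∞ S]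

/-- The function `r` on the cone. -/
def radius (p : Cone S) : ℝ := (p.1 : ℝ)

/-- The action `λ_a (r, x) = (a r, x)` of `a > 0` on the cone. -/
def dilation (a : ℝ) (ha : 0 < a) (p : Cone S) : Cone S :=
  (⟨a * (p.1 : ℝ), mul_pos ha p.1.2⟩, p.2)

/-- The inclusion `x ↦ (1, x)` of `S` in its cone as the hypersurface `r = 1`. -/
def unitSection (x : S) : Cone S := (⟨1, show (0 : ℝ) < 1 from one_pos⟩, x)

/-- A subset of `C(S)` is a cone if it is invariant under all the dilations. -/
def IsCone (A : Set (Cone S)) : Prop :=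
  ∀ (a : ℝ) (ha : 0 < a), ∀ p ∈ A, dilation a ha p ∈ A

/-- The link `A ∩ S` of a subset `A` of `C(S)`, as a subset of `S`. -/
def link (A : Set (Cone S)) : Set S := {x | unitSection x ∈ A}

/-- The cone metric `dr² + r² g`. -/
def coneMetric
    (g : ContMDiffRiemannianMetric (baseModel n) ∞ (EuclideanSpace ℝ (Fin (2 * n + 1)))
      (fun x : S ↦ TangentSpace (baseModel n) x))
    (p : Cone S) (u v : TangentSpace (coneModel n) p) : ℝ :=
  dirDeriv (coneModel n) radius p u * dirDeriv (coneModel n) radius p v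
    + (radius p) ^ 2 * g.inner p.2 (mfderiv (coneModel n) (baseModel n) Prod.snd p u)
        (mfderiv (coneModel n) (baseModel n) Prod.snd p v)

/-- The Euler vector field `r ∂/∂r` on the cone, in the splitting `T(ℝ_{>0}) × TS` of the tangent
bundle of the cone. -/
def eulerField (p : Cone S) : TangentSpace (coneModel n) p :=
  (radius p, (0 : EuclideanSpace ℝ (Fin (2 * n + 1))))

/-- `(S, g)` is a Sasaki manifold, with `J` as the complex structure of its cone: the metric cone
is Kähler for `J`. -/
def IsSasaki
    (g : ContMDiffRiemannianMetric (baseModel n) ∞ (EuclideanSpace ℝ (Fin (2 * n + 1)))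
      (fun x : S ↦ TangentSpace (baseModel n) x))
    (J : ∀ p : Cone S, TangentSpace (coneModel n) p →L[ℝ] TangentSpace (coneModel n) p) : Prop :=
  IsKahler (coneModel n) (coneMetric g) J

/-- The form `η(v) = r⁻² ḡ(ξ, v)` on the cone, where `ξ = J(r ∂/∂r)`. -/
def coneContactForm
    (g : ContMDiffRiemannianMetric (baseModel n) ∞ (EuclideanSpace ℝ (Fin (2 * n + 1)))
      (fun x : S ↦ TangentSpace (baseModel n) x))
    (J : ∀ p : Cone S, TangentSpace (coneModel n) p →L[ℝ] TangentSpace (coneModel n) p)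
    (p : Cone S) (v : TangentSpace (coneModel n) p) : ℝ :=
  1 / (radius p) ^ 2 * coneMetric g p (J p (eulerField p)) v

/-- The contact form of the Sasaki manifold `S`: the restriction of `η` to `S`. -/
def contactForm
    (g : ContMDiffRiemannianMetric (baseModel n) ∞ (EuclideanSpace ℝ (Fin (2 * n + 1)))
      (fun x : S ↦ TangentSpace (baseModel n) x))
    (J : ∀ p : Cone S, TangentSpace (coneModel n) p →L[ℝ] TangentSpace (coneModel n) p)
    (x : S) (v : TangentSpace (baseModel n) x) : ℝ :=
  coneContactForm g J (unitSection x) (mfderiv (baseModel n) (coneModel n) unitSection x v)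

/-- `L` is a Legendrian submanifold of the Sasaki manifold `S` of dimension `2n+1`: a submanifold
of dimension `n` on which the contact form vanishes. -/
def IsLegendrian
    (g : ContMDiffRiemannianMetric (baseModel n) ∞ (EuclideanSpace ℝ (Fin (2 * n + 1)))
      (fun x : S ↦ TangentSpace (baseModel n) x))
    (J : ∀ p : Cone S, TangentSpace (coneModel n) p →L[ℝ] TangentSpace (coneModel n) p)
    (L : Set S) : Prop :=
  IsSubmanifold (baseModel n) n L ∧
    ∀ x ∈ L, ∀ v ∈ tangentVectors (baseModel n) L x, contactForm g J x v = 0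

end Cone

end

/-!
The involution `τ` of the cone is not assumed to be an isometry, and this is the first thing to
prove. Write `h` for the cone metric, `R = r ∂/∂r` for the Euler field and `ω` for the Kähler form.
Since `J` is parallel (`IsKahler.koszul_add`) and `∇_X R = X` (`koszul_eulerField`), the Kähler form
is exact: `2ω = dθ` for `θ = h(JR, ·) = -r dr ∘ J` (`two_mul_fundamentalForm`). As `τ` preserves `r`
and anticommutes with `J`, one gets `τ^*θ = -θ` and `τ^*ω = -ω`
(`reebForm_mfderiv`, `fundamentalForm_mfderiv`), and therefore `τ^*h = h` (`coneMetric_mfderiv`). So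
`τ` preserves `R`, which is the gradient of `r² / 2`, and commutes with the flow of `R`, that is,
with the dilations (`map_ray`). Hence `τ(r, x) = (r, σ(x))` for an isometric involution `σ` of `S`
(`apply_eq_prod_linkMap`, `inner_mfderiv_linkMap`), the fixed point set of `τ` is the cone over that
of `σ`, and the latter is the link.

A smooth involution is linear in a suitable chart at each of its fixed points
(`exists_chart_linearizing_involution`). So its fixed point set is a submanifold, with the fixed
space of the differential as tangent space (`isSubmanifold_fixedPoints`,
`mem_tangentVectors_fixedPoints_iff`). At a fixed point of `τ` the endomorphism `J` exchanges the
eigenspaces of `dτ` for `1` and `-1`, which gives the dimension `n + 1`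
(`two_mul_finrank_eqLocus_of_anticommute`). The fixed space of `dτ` contains the direction of `R`,
which leaves the dimension `n` for the link. The forms `ω` and `θ` vanish on fixed vectors because
`τ` changes their signs.

The link is totally geodesic because it is the fixed point set of an isometric involution
(`isTotallyGeodesic_fixedPoints`). For fields `X` and `Y` tangent to it, `∇_X Y` depends on `X` at
the point and on `Y` along the link only, so replacing `X` and `Y` by their pullbacks under `σ` does
not change it; as `σ` is an isometry, `∇_X Y` is fixed by `dσ`. The Levi-Civita connection enters
through the Koszul form alone, whose tensoriality gives both the existence of `∇_X Y`
(`exists_isLeviCivitaDerivAt`) and these locality properties.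
-/

noncomputable section

/-! ### Derivatives along vector fields and the Lie bracket -/

section Calculus

variable {E : Type*} [NormedAddCommGroup E] [NormedSpace ℝ E]
  {H : Type*} [TopologicalSpace H] {I : ModelWithCorners ℝ E H}
  {M : Type*} [TopologicalSpace M] [ChartedSpace H M]
  {E' : Type*} [NormedAddCommGroup E'] [NormedSpace ℝ E']
  {H' : Type*} [TopologicalSpace H'] {I' : ModelWithCorners ℝ E' H'}
  {N : Type*} [TopologicalSpace N] [ChartedSpace H' N]

theorem dirDeriv_eq_mvfderiv (f : M → ℝ) (p : M) (v : TangentSpace I p) :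
    dirDeriv I f p v = mvfderiv I f p v := rfl

theorem dirDeriv_add {f g : M → ℝ} {p : M} (hf : MDifferentiableAt I 𝓘(ℝ, ℝ) f p)
    (hg : MDifferentiableAt I 𝓘(ℝ, ℝ) g p) (v : TangentSpace I p) :
    dirDeriv I (fun q ↦ f q + g q) p v = dirDeriv I f p v + dirDeriv I g p v := by
  have := mvfderiv_add hf hg
  exact congrArg (fun L ↦ L v) this

theorem dirDeriv_neg (f : M → ℝ) (p : M) (v : TangentSpace I p) :
    dirDeriv I (fun q ↦ -f q) p v = -dirDeriv I f p v := by
  have := mvfderiv_neg (I := I) (g := f) (x := p)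
  exact congrArg (fun L ↦ L v) this

theorem dirDeriv_mul {f g : M → ℝ} {p : M} (hf : MDifferentiableAt I 𝓘(ℝ, ℝ) f p)
    (hg : MDifferentiableAt I 𝓘(ℝ, ℝ) g p) (v : TangentSpace I p) :
    dirDeriv I (fun q ↦ f q * g q) p v
      = f p * dirDeriv I g p v + g p * dirDeriv I f p v := by
  have := mvfderiv_mul hf hg
  exact congrArg (fun L ↦ L v) this

theorem dirDeriv_congr {f g : M → ℝ} {p : M} (h : f =ᶠ[𝓝 p] g) (v : TangentSpace I p) :
    dirDeriv I f p v = dirDeriv I g p v := by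
  unfold dirDeriv
  rw [h.mfderiv_eq]
  rfl

theorem dirDeriv_comp {φ : M → N} {f : N → ℝ} {p : M}
    (hf : MDifferentiableAt I' 𝓘(ℝ, ℝ) f (φ p)) (hφ : MDifferentiableAt I I' φ p)
    (v : TangentSpace I p) :
    dirDeriv I (fun q ↦ f (φ q)) p v = dirDeriv I' f (φ p) (mfderiv I I' φ p v) :=
  mvfderiv_comp_apply (g := f) (f := φ) p hf hφ v

theorem SmoothFieldAt.mdifferentiableAt [IsManifold I ∞ M] {X : ∀ q : M, TangentSpace I q} {p : M}
    (h : SmoothFieldAt I X p) :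
    MDifferentiableAt I I.tangent (fun q ↦ (⟨q, X q⟩ : TangentBundle I M)) p :=
  ContMDiffAt.mdifferentiableAt h (by simp)

theorem smoothFieldAt_extend [IsManifold I ∞ M] {p : M} (v : TangentSpace I p) :
    SmoothFieldAt I (FiberBundle.extend E v) p :=
  FiberBundle.contMDiffAt_extend I E v

variable (I) in
/-- The coordinate expression of the vector field `X` in the chart at `p`, as a map from the model
vector space to itself. It is meaningful on the target of that chart only. -/
def coordField (p : M) (X : ∀ q : M, TangentSpace I q) (y : E) : E :=
  VectorField.mpullbackWithin 𝓘(ℝ, E) I (extChartAt I p).symm X (range I) y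

/-- In the chart at `p`, a vector field is the pullback of its coordinate expression. -/
theorem eventually_mfderiv_extChartAt_apply (p : M) [I.Boundaryless] [IsManifold I ∞ M]
    (X : ∀ q : M, TangentSpace I q) :
    ∀ᶠ q in 𝓝 p, mfderiv I 𝓘(ℝ, E) (extChartAt I p) q (X q) =
      coordField I p X (extChartAt I p q) := by
  have h1 := VectorField.eventuallyEq_mpullback_mpullbackWithin_extChartAt (s := univ) (x := p) X
  rw [nhdsWithin_univ] at h1
  filter_upwards [h1, extChartAt_source_mem_nhds (I := I) p] with q hq hs
  rw [hq, VectorField.mpullback_apply]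
  have := isInvertible_mfderiv_extChartAt hs
  exact this.self_apply_inverse _

/-- In the chart at `p`, the derivative of `f` along a vector field is the derivative of the
coordinate expression of `f` along that of the field. -/
theorem mvfderiv_apply_field_chart {F : Type*} [NormedAddCommGroup F] [NormedSpace ℝ F]
    [CompleteSpace E] [I.Boundaryless] [IsManifold I ∞ M] {f : M → F} {p : M}
    (hf : ContMDiffAt I 𝓘(ℝ, F) ∞ f p) {X : ∀ q : M, TangentSpace I q} :
    ∀ᶠ q in 𝓝 p, mvfderiv I f q (X q) =
      fderiv ℝ (f ∘ (extChartAt I p).symm) (extChartAt I p q)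
        (coordField I p X (extChartAt I p q)) := by
  have hE : ∀ᶠ q in 𝓝 p, ContMDiffAt I 𝓘(ℝ, F) 1 f q := by
    have : ContMDiffAt I 𝓘(ℝ, F) 1 f p := hf.of_le (by norm_cast)
    exact (contMDiffAt_iff_contMDiffAt_nhds (by simp)).1 this
  filter_upwards [hE, eventually_mfderiv_extChartAt_apply p X,
    extChartAt_source_mem_nhds (I := I) p] with q hq hX hs
  rw [← hX]
  have hfq : MDifferentiableAt I 𝓘(ℝ, F) f ((extChartAt I p).symm (extChartAt I p q)) := by
    rw [(extChartAt I p).left_inv hs]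
    exact hq.mdifferentiableAt (by simp)
  have hsymm : MDifferentiableAt 𝓘(ℝ, E) I (extChartAt I p).symm (extChartAt I p q) := by
    have := mdifferentiableWithinAt_extChartAt_symm ((extChartAt I p).map_source hs)
    rwa [I.range_eq_univ, mdifferentiableWithinAt_univ] at this
  have hg : MDifferentiableAt 𝓘(ℝ, E) 𝓘(ℝ, F) (f ∘ (extChartAt I p).symm) (extChartAt I p q) :=
    hfq.comp _ hsymm
  have hφ : MDifferentiableAt I 𝓘(ℝ, E) (extChartAt I p) q :=
    mdifferentiableAt_extChartAt (by simpa using hs)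
  have key : f =ᶠ[𝓝 q] (f ∘ (extChartAt I p).symm) ∘ extChartAt I p := by
    filter_upwards [(isOpen_extChartAt_source (I := I) p).mem_nhds hs] with y hy
    exact congrArg f ((extChartAt I p).left_inv hy).symm
  have h1 : mfderiv I 𝓘(ℝ, F) f q (X q)
      = mfderiv I 𝓘(ℝ, F) ((f ∘ (extChartAt I p).symm) ∘ extChartAt I p) q (X q) := by
    rw [key.mfderiv_eq]; rfl
  rw [mfderiv_comp_apply q hg hφ] at h1
  rw [mfderiv_eq_fderiv] at h1
  exact h1

theorem differentiableAt_pullback_extChartAt [CompleteSpace E] [I.Boundaryless] [IsManifold I ∞ M]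
    {p : M} {X : ∀ q : M, TangentSpace I q} (hX : SmoothFieldAt I X p) :
    DifferentiableAt ℝ (coordField I p X)
      (extChartAt I p p) := by
  have : IsManifold I 2 M := IsManifold.of_le (n := ∞) (by norm_cast)
  have h := MDifferentiableWithinAt.differentiableWithinAt_mpullbackWithin_vectorField
    (s := univ) hX.mdifferentiableAt.mdifferentiableWithinAt
  rw [preimage_univ, univ_inter] at h
  refine differentiableWithinAt_univ.1 ?_
  rwa [← I.range_eq_univ]

theorem contDiffAt_comp_extChartAt_symm {F : Type*} [NormedAddCommGroup F] [NormedSpace ℝ F]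
    [I.Boundaryless] [IsManifold I ∞ M] {f : M → F} {p : M}
    (hf : ContMDiffAt I 𝓘(ℝ, F) ∞ f p) :
    ContDiffAt ℝ ∞ (f ∘ (extChartAt I p).symm) (extChartAt I p p) := by
  rw [← contMDiffAt_iff_contDiffAt]
  refine ContMDiffAt.comp (I' := I) _ ?_ ?_
  · rwa [extChartAt_to_inv]
  · have := contMDiffWithinAt_extChartAt_symm_range (n := ∞) (I := I) p (mem_extChartAt_target p)
    rwa [I.range_eq_univ, contMDiffWithinAt_univ] at this

theorem differentiableAt_fderiv_apply_pullback {F : Type*} [NormedAddCommGroup F]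
    [NormedSpace ℝ F] [CompleteSpace E] [I.Boundaryless] [IsManifold I ∞ M] {f : M → F} {p : M}
    (hf : ContMDiffAt I 𝓘(ℝ, F) ∞ f p) :
    DifferentiableAt ℝ (fderiv ℝ (f ∘ (extChartAt I p).symm)) (extChartAt I p p) :=
  ((contDiffAt_comp_extChartAt_symm hf).fderiv_right (m := 1) (by norm_cast)).differentiableAt
    (by simp)

theorem mdifferentiableAt_mvfderiv_apply {F : Type*} [NormedAddCommGroup F] [NormedSpace ℝ F]
    [CompleteSpace E] [I.Boundaryless] [IsManifold I ∞ M] {f : M → F} {p : M}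
    (hf : ContMDiffAt I 𝓘(ℝ, F) ∞ f p) {X : ∀ q : M, TangentSpace I q}
    (hX : SmoothFieldAt I X p) :
    MDifferentiableAt I 𝓘(ℝ, F) (fun q ↦ mvfderiv I f q (X q)) p := by
  refine MDifferentiableAt.congr_of_eventuallyEq ?_ (mvfderiv_apply_field_chart hf (X := X))
  have h2 := (differentiableAt_fderiv_apply_pullback hf).clm_apply
    (differentiableAt_pullback_extChartAt hX)
  exact h2.comp_mdifferentiableAt (mdifferentiableAt_extChartAt (mem_chart_source H p))

theorem mvfderiv_mvfderiv_apply {F : Type*} [NormedAddCommGroup F] [NormedSpace ℝ F]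
    [CompleteSpace E] [I.Boundaryless] [IsManifold I ∞ M] {f : M → F} {p : M}
    (hf : ContMDiffAt I 𝓘(ℝ, F) ∞ f p) {X : ∀ q : M, TangentSpace I q}
    (hX : SmoothFieldAt I X p) (v : TangentSpace I p) :
    mvfderiv I (fun q ↦ mvfderiv I f q (X q)) p v =
      fderiv ℝ (fun y ↦ fderiv ℝ (f ∘ (extChartAt I p).symm) y
        (coordField I p X y))
        (extChartAt I p p) (mfderiv I 𝓘(ℝ, E) (extChartAt I p) p v) := by
  have h2 := (differentiableAt_fderiv_apply_pullback hf).clm_apply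
    (differentiableAt_pullback_extChartAt hX)
  have hφ : MDifferentiableAt I 𝓘(ℝ, E) (extChartAt I p) p :=
    mdifferentiableAt_extChartAt (mem_chart_source H p)
  have h1 : mfderiv I 𝓘(ℝ, F) (fun q ↦ mvfderiv I f q (X q)) p v = mfderiv I 𝓘(ℝ, F)
      ((fun y ↦ fderiv ℝ (f ∘ (extChartAt I p).symm) y
        (coordField I p X y)) ∘
          extChartAt I p) p v := by
    rw [Filter.EventuallyEq.mfderiv_eq (mvfderiv_apply_field_chart hf (X := X))]; rfl
  rw [mfderiv_comp_apply p h2.mdifferentiableAt hφ, mfderiv_eq_fderiv] at h1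
  exact h1

theorem fderiv_lieBracket_apply {F : Type*} [NormedAddCommGroup F] [NormedSpace ℝ F]
    {k : E → F} {U V : E → E} {y : E} (hD : DifferentiableAt ℝ (fderiv ℝ k) y)
    (hk : IsSymmSndFDerivAt ℝ k y) (hU : DifferentiableAt ℝ U y) (hV : DifferentiableAt ℝ V y) :
    fderiv ℝ k y (VectorField.lieBracket ℝ U V y) =
      fderiv ℝ (fun y ↦ fderiv ℝ k y (V y)) y (U y)
        - fderiv ℝ (fun y ↦ fderiv ℝ k y (U y)) y (V y) := by
  rw [fderiv_clm_apply hD hU, fderiv_clm_apply hD hV, VectorField.lieBracket_eq]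
  simp [hk (U y) (V y)]

/-- The Lie bracket of vector fields is the commutator of the derivations that they define on the
functions with values in a normed space. -/
theorem mvfderiv_mlieBracket {F : Type*} [NormedAddCommGroup F] [NormedSpace ℝ F]
    [CompleteSpace E] [I.Boundaryless] [IsManifold I ∞ M] {f : M → F} {p : M}
    (hf : ContMDiffAt I 𝓘(ℝ, F) ∞ f p) {X Y : ∀ q : M, TangentSpace I q}
    (hX : SmoothFieldAt I X p) (hY : SmoothFieldAt I Y p) :
    mvfderiv I f p (VectorField.mlieBracket I X Y p) =
      mvfderiv I (fun q ↦ mvfderiv I f q (Y q)) p (X p)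
        - mvfderiv I (fun q ↦ mvfderiv I f q (X q)) p (Y p) := by
  rw [mvfderiv_mvfderiv_apply hf hX, mvfderiv_mvfderiv_apply hf hY,
    (mvfderiv_apply_field_chart hf (X := VectorField.mlieBracket I X Y)).self_of_nhds,
    ← (eventually_mfderiv_extChartAt_apply p (VectorField.mlieBracket I X Y)).self_of_nhds,
    (eventually_mfderiv_extChartAt_apply p X).self_of_nhds,
    (eventually_mfderiv_extChartAt_apply p Y).self_of_nhds]
  have hD := differentiableAt_fderiv_apply_pullback hf
  have hsym := (contDiffAt_comp_extChartAt_symm hf).isSymmSndFDerivAt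
    (by rw [minSmoothness_of_isRCLikeNormedField]; norm_cast)
  have hX' := differentiableAt_pullback_extChartAt hX
  have hY' := differentiableAt_pullback_extChartAt hY
  have hbr : mfderiv I 𝓘(ℝ, E) (extChartAt I p) p (VectorField.mlieBracket I X Y p) =
      VectorField.lieBracket ℝ
        (coordField I p X)
        (coordField I p Y)
        (extChartAt I p p) := by
    have hi := isInvertible_mfderiv_extChartAt (I := I) (mem_extChartAt_source p)
    refine (hi.self_apply_inverse _).trans ?_
    rw [preimage_univ, univ_inter]
    change VectorField.lieBracketWithin ℝ (coordField I p X) (coordField I p Y) (range I) _ = _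
    rw [I.range_eq_univ, VectorField.lieBracketWithin_univ]
  rw [hbr]
  exact fderiv_lieBracket_apply hD hsym hX' hY'

end Calculus

/-! ### The Koszul form and Kähler structures -/

section BilinearFields

variable {E : Type*} [NormedAddCommGroup E] [NormedSpace ℝ E]
  {H : Type*} [TopologicalSpace H] {I : ModelWithCorners ℝ E H}
  {M : Type*} [TopologicalSpace M] [ChartedSpace H M]

variable (I) in
/-- `h` is a field of symmetric bilinear forms on the tangent spaces. Neither smoothness nor
definiteness is required. -/
structure IsSymmBilinField (h : ∀ p : M, TangentSpace I p → TangentSpace I p → ℝ) : Prop where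
  symm : ∀ p u v, h p u v = h p v u
  add_left : ∀ p u v w, h p (u + v) w = h p u w + h p v w
  smul_left : ∀ p (c : ℝ) u w, h p (c • u) w = c * h p u w

namespace IsSymmBilinField

variable {h : ∀ p : M, TangentSpace I p → TangentSpace I p → ℝ} (hh : IsSymmBilinField I h)
include hh

theorem neg_left (p : M) (u w : TangentSpace I p) : h p (-u) w = -h p u w := by
  have := hh.smul_left p (-1) u w
  rw [neg_one_smul] at this
  linarith

theorem neg_right (p : M) (u w : TangentSpace I p) : h p u (-w) = -h p u w := by
  rw [hh.symm, hh.neg_left, hh.symm]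

theorem sub_left (p : M) (u v w : TangentSpace I p) : h p (u - v) w = h p u w - h p v w := by
  rw [sub_eq_add_neg, hh.add_left, hh.neg_left]; ring

theorem add_right (p : M) (u v w : TangentSpace I p) : h p u (v + w) = h p u v + h p u w := by
  rw [hh.symm, hh.add_left, hh.symm p v, hh.symm p w]

theorem smul_right (p : M) (c : ℝ) (u w : TangentSpace I p) : h p u (c • w) = c * h p u w := by
  rw [hh.symm, hh.smul_left, hh.symm]

theorem zero_left (p : M) (w : TangentSpace I p) : h p 0 w = 0 := by
  simpa using hh.smul_left p 0 0 w

end IsSymmBilinField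

end BilinearFields

section Kahler

variable {E : Type*} [NormedAddCommGroup E] [NormedSpace ℝ E]
  {H : Type*} [TopologicalSpace H] {I : ModelWithCorners ℝ E H}
  {M : Type*} [TopologicalSpace M] [ChartedSpace H M]

variable (I) in
/-- The right-hand side of the Koszul formula: for the Levi-Civita connection `∇` of `h`, it is
`2 h(∇_X Y, Z)` at `p`. -/
def koszul (h : ∀ p : M, TangentSpace I p → TangentSpace I p → ℝ)
    (X Y Z : ∀ q : M, TangentSpace I q) (p : M) : ℝ :=
  dirDeriv I (fun q ↦ h q (Y q) (Z q)) p (X p)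
    + dirDeriv I (fun q ↦ h q (Z q) (X q)) p (Y p)
    - dirDeriv I (fun q ↦ h q (X q) (Y q)) p (Z p)
    + h p (VectorField.mlieBracket I X Y p) (Z p)
    - h p (VectorField.mlieBracket I Y Z p) (X p)
    + h p (VectorField.mlieBracket I Z X p) (Y p)

/-- The part of the Koszul form that is skew in the first and last fields is the exterior
derivative of the 1-form dual to the middle field. -/
theorem koszul_sub_koszul_swap {h : ∀ p : M, TangentSpace I p → TangentSpace I p → ℝ}
    (hh : IsSymmBilinField I h) (X Y Z : ∀ q : M, TangentSpace I q) (p : M) :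
    koszul I h X Y Z p - koszul I h Z Y X p =
      2 * (dirDeriv I (fun q ↦ h q (Y q) (Z q)) p (X p)
        - dirDeriv I (fun q ↦ h q (Y q) (X q)) p (Z p)
        - h p (Y p) (VectorField.mlieBracket I X Z p)) := by
  unfold koszul
  rw [VectorField.mlieBracket_swap_apply (V := Z) (W := Y),
    VectorField.mlieBracket_swap_apply (V := Y) (W := X),
    VectorField.mlieBracket_swap_apply (V := Z) (W := X)]
  simp only [hh.neg_left, hh.symm _ (X _) (Y _), hh.symm _ (Z _) (X _), hh.symm _ (Z _) (Y _),
    hh.symm _ (Y _) (VectorField.mlieBracket I X Z p)]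
  ring

/-- The part of the Koszul form that is symmetric in the last two fields: the Levi-Civita
connection is metric. -/
theorem koszul_add_koszul_swap {h : ∀ p : M, TangentSpace I p → TangentSpace I p → ℝ}
    (hh : IsSymmBilinField I h) (X Y Z : ∀ q : M, TangentSpace I q) (p : M) :
    koszul I h X Y Z p + koszul I h X Z Y p =
      2 * dirDeriv I (fun q ↦ h q (Y q) (Z q)) p (X p) := by
  unfold koszul
  rw [VectorField.mlieBracket_swap_apply (V := Y) (W := X),
    VectorField.mlieBracket_swap_apply (V := Z) (W := Y),
    VectorField.mlieBracket_swap_apply (V := Z) (W := X)]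
  simp only [hh.neg_left, hh.symm _ (X _) (Y _), hh.symm _ (Z _) (X _), hh.symm _ (Z _) (Y _)]
  ring

variable [IsManifold I ∞ M]

theorem IsComplexStructure.smoothFieldAt_apply
    {J : ∀ p : M, TangentSpace I p →L[ℝ] TangentSpace I p} (hJ : IsComplexStructure I J)
    {X : ∀ q : M, TangentSpace I q} {p : M} (hX : SmoothFieldAt I X p) :
    SmoothFieldAt I (fun q ↦ J q (X q)) p :=
  ContMDiffAt.clm_bundle_apply (b := fun q : M ↦ q) (F₁ := E) (F₂ := E)
    (E₁ := fun q : M ↦ TangentSpace I q) (E₂ := fun q : M ↦ TangentSpace I q)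
    (hJ.smooth p) hX

/-- For a Kähler structure `J` is parallel: `h(∇_X (JY), Z) = h(J ∇_X Y, Z)`. The identity is the
difference of `dω(X, Y, Z) = 0` and `dω(X, JY, JZ) = 0`, corrected by `h(J N(Y, Z), X) = 0` for
the Nijenhuis tensor `N`. -/
theorem IsKahler.koszul_add {h : ∀ p : M, TangentSpace I p → TangentSpace I p → ℝ}
    (hh : IsSymmBilinField I h) {J : ∀ p : M, TangentSpace I p →L[ℝ] TangentSpace I p}
    (hK : IsKahler I h J) {X Y Z : ∀ q : M, TangentSpace I q} {p : M}
    (hX : SmoothFieldAt I X p) (hY : SmoothFieldAt I Y p) (hZ : SmoothFieldAt I Z p) :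
    koszul I h X (fun q ↦ J q (Y q)) Z p + koszul I h X Y (fun q ↦ J q (Z q)) p = 0 := by
  have hJY := hK.complex.smoothFieldAt_apply hY
  have hJZ := hK.complex.smoothFieldAt_apply hZ
  have hskew : ∀ q u v, h q u (J q v) = -h q (J q u) v := fun q u v ↦ by
    rw [← hK.hermitian q u (J q v), hK.complex.sq_eq_neg, hh.neg_right]
  have hskew' : ∀ q u v, h q (J q u) v = -h q u (J q v) := fun q u v ↦ by
    rw [hskew, neg_neg]
  have d1 := hK.closed p X Y Z hX hY hZ
  have d2 := hK.closed p X (fun q ↦ J q (Y q)) (fun q ↦ J q (Z q)) hX hJY hJZ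
  have hN : h p (J p (VectorField.mlieBracket I (fun q ↦ J q (Y q)) (fun q ↦ J q (Z q)) p))
        (X p)
      - h p (J p (VectorField.mlieBracket I Y Z p)) (X p)
      + h p (VectorField.mlieBracket I Y (fun q ↦ J q (Z q)) p) (X p)
      + h p (VectorField.mlieBracket I (fun q ↦ J q (Y q)) Z p) (X p) = 0 := by
    have := congrArg (fun v ↦ h p (J p v) (X p)) (hK.complex.integrable p Y Z hY hZ)
    simp only [map_sub, map_zero, hh.sub_left, hK.complex.sq_eq_neg, hh.neg_left,
      hh.zero_left] at this
    linarith
  simp only [fundamentalForm, hK.complex.sq_eq_neg, hh.neg_left] at d1 d2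
  simp only [hskew' _ (VectorField.mlieBracket I X Y p), hskew' _ (X _), hskew' p
    (VectorField.mlieBracket I Z X p)] at d1
  simp only [hK.hermitian] at d2
  simp only [dirDeriv_neg] at d1 d2
  unfold koszul
  simp only [hskew' _ (Y _) (Z _), dirDeriv_neg] at d1 ⊢
  linarith

end Kahler

/-! ### The Euler field of the cone and its flow -/

section HalfLine

theorem extChartAt_posReal_apply (r s : posReal) : extChartAt 𝓘(ℝ, ℝ) r s = (s : ℝ) := by
  simp [mfld_simps, chartAt, ChartedSpace.chartAt]

theorem mfderiv_posReal_val (r : posReal) (v : TangentSpace 𝓘(ℝ, ℝ) r) :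
    mfderiv 𝓘(ℝ, ℝ) 𝓘(ℝ, ℝ) (Subtype.val : posReal → ℝ) r v = v := by
  have h : (Subtype.val : posReal → ℝ) = extChartAt 𝓘(ℝ, ℝ) r := by
    funext s; exact (extChartAt_posReal_apply r s).symm
  rw [h]
  have := mfderiv_extChartAt_self (I := 𝓘(ℝ, ℝ)) (x := r)
  exact congrArg (fun L ↦ L v) this

/-- A map to the half-line has the derivative of its composition with the inclusion in `ℝ`, whose
differential is the identity of the tangent spaces. -/
theorem hasMFDerivAt_posReal {E : Type*} [NormedAddCommGroup E] [NormedSpace ℝ E]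
    {H : Type*} [TopologicalSpace H] {I : ModelWithCorners ℝ E H}
    {M : Type*} [TopologicalSpace M] [ChartedSpace H M] {f : M → posReal} {p : M}
    {L : TangentSpace I p →L[ℝ] ℝ} (h : HasMFDerivAt I 𝓘(ℝ, ℝ) (fun q ↦ (f q : ℝ)) p L) :
    HasMFDerivAt I 𝓘(ℝ, ℝ) f p L := by
  refine ⟨Topology.IsInducing.subtypeVal.continuousAt_iff.2 h.1, ?_⟩
  have : writtenInExtChartAt I 𝓘(ℝ, ℝ) p f =
      writtenInExtChartAt I 𝓘(ℝ, ℝ) p (fun q ↦ (f q : ℝ)) := by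
    funext y
    simp only [writtenInExtChartAt, Function.comp, extChartAt_posReal_apply,
      extChartAt_model_space_eq_id, PartialEquiv.refl_coe, id]
  rw [this]
  exact h.2

theorem contMDiff_posReal_val : ContMDiff 𝓘(ℝ, ℝ) 𝓘(ℝ, ℝ) ∞ (Subtype.val : posReal → ℝ) :=
  contMDiff_subtype_val

theorem contMDiff_posReal_eulerField : ContMDiff 𝓘(ℝ, ℝ) 𝓘(ℝ, ℝ).tangent ∞
    (fun r : posReal ↦ (⟨r, (r : ℝ)⟩ : TangentBundle 𝓘(ℝ, ℝ) posReal)) := by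
  intro r₀
  refine (contMDiffAt_section (E := TangentSpace 𝓘(ℝ, ℝ)) (s := fun r : posReal ↦ (r : ℝ))
    r₀).2 ?_
  refine (contMDiff_posReal_val r₀).congr_of_eventuallyEq (Eventually.of_forall fun r ↦ ?_)
  have h : r ∈ (chartAt ℝ r₀).source := by
    simp [mfld_simps, chartAt, ChartedSpace.chartAt]
  have h2 := TangentBundle.continuousLinearMapAt_trivializationAt (I := 𝓘(ℝ, ℝ)) (x₀ := r₀) h
  have h3 : (Subtype.val : posReal → ℝ) = extChartAt 𝓘(ℝ, ℝ) r₀ := by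
    funext s; exact (extChartAt_posReal_apply r₀ s).symm
  rw [← h3] at h2
  have h4 := congrArg (fun L ↦ L (r : ℝ)) h2
  refine Eq.trans ?_ (h4.trans (mfderiv_posReal_val r _))
  refine (Trivialization.coe_linearMapAt_of_mem (R := ℝ)
    (trivializationAt ℝ (TangentSpace 𝓘(ℝ, ℝ)) r₀) (b := r) ?_ ▸ rfl)
  exact h

end HalfLine

section Cone

variable {n : ℕ} {S : Type*} [TopologicalSpace S]
  [ChartedSpace (EuclideanSpace ℝ (Fin (2 * n + 1))) S]

theorem contMDiff_radius : ContMDiff (coneModel n) 𝓘(ℝ, ℝ) ∞ (radius : Cone S → ℝ) :=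
  contMDiff_posReal_val.comp contMDiff_fst

theorem dirDeriv_radius (p : Cone S) (v : TangentSpace (coneModel n) p) :
    dirDeriv (coneModel n) radius p v = (v : ℝ × EuclideanSpace ℝ (Fin (2 * n + 1))).1 := by
  have h1 := mfderiv_comp_apply (I' := 𝓘(ℝ, ℝ)) p (g := (Subtype.val : posReal → ℝ))
    (f := (Prod.fst : Cone S → posReal)) (contMDiff_posReal_val.mdifferentiableAt (by simp))
    (mdifferentiableAt_fst (I := 𝓘(ℝ, ℝ)) (I' := baseModel n)) v
  rw [mfderiv_posReal_val, mfderiv_fst] at h1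
  exact h1

theorem mfderiv_cone_snd (p : Cone S) (v : TangentSpace (coneModel n) p) :
    mfderiv (coneModel n) (baseModel n) Prod.snd p v =
      (v : ℝ × EuclideanSpace ℝ (Fin (2 * n + 1))).2 := by
  rw [mfderiv_snd]
  rfl

theorem contMDiff_eulerField [IsManifold (baseModel n) ∞ S] :
    ContMDiff (coneModel n) (coneModel n).tangent ∞
      (fun p : Cone S ↦ (⟨p, eulerField p⟩ : TangentBundle (coneModel n) (Cone S))) := by
  have h1 := contMDiff_equivTangentBundleProd_symm (n := ∞) (I := 𝓘(ℝ, ℝ)) (M := posReal)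
    (I' := baseModel n) (M' := S)
  have h2 : ContMDiff (coneModel n) (baseModel n).tangent ∞
      (fun p : Cone S ↦ (⟨p.2, 0⟩ : TangentBundle (baseModel n) S)) :=
    (contMDiff_zeroSection ℝ (TangentSpace (baseModel n) (M := S))).comp contMDiff_snd
  exact h1.comp ((contMDiff_posReal_eulerField.comp contMDiff_fst).prodMk h2)

/-- The orbit of a point under the flow of the Euler field. -/
def ray (p : Cone S) (t : ℝ) : Cone S := dilation (Real.exp t) (Real.exp_pos t) p

theorem isMIntegralCurve_ray (p : Cone S) :
    IsMIntegralCurve (I := coneModel n) (ray p) eulerField := by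
  intro t
  have h1 : HasMFDerivAt 𝓘(ℝ, ℝ) 𝓘(ℝ, ℝ) (fun t : ℝ ↦ (ray p t).1) t
      (ContinuousLinearMap.toSpanSingleton ℝ (Real.exp t * (p.1 : ℝ))) :=
    hasMFDerivAt_posReal (f := fun t : ℝ ↦ (ray p t).1)
      (((Real.hasDerivAt_exp t).mul_const (p.1 : ℝ)).hasFDerivAt.hasMFDerivAt)
  have h2 : HasMFDerivAt 𝓘(ℝ, ℝ) (baseModel n) (fun _ : ℝ ↦ p.2) t 0 := hasMFDerivAt_const _ _
  have h3 := h1.prodMk h2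
  have e : (ContinuousLinearMap.toSpanSingleton ℝ (Real.exp t * (p.1 : ℝ))).prod
      (0 : ℝ →L[ℝ] EuclideanSpace ℝ (Fin (2 * n + 1))) =
      (1 : ℝ →L[ℝ] ℝ).smulRight
        ((Real.exp t * (p.1 : ℝ), 0) : ℝ × EuclideanSpace ℝ (Fin (2 * n + 1))) :=
    ContinuousLinearMap.ext fun s ↦ Prod.ext (by simp) (by simp)
  exact e ▸ h3

end Cone

/-! ### The cone metric -/

section ConeMetric

variable {n : ℕ} {S : Type*} [TopologicalSpace S]
  [ChartedSpace (EuclideanSpace ℝ (Fin (2 * n + 1))) S] [IsManifold (baseModel n) ∞ S]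
  (g : ContMDiffRiemannianMetric (baseModel n) ∞ (EuclideanSpace ℝ (Fin (2 * n + 1)))
      (fun x : S ↦ TangentSpace (baseModel n) x))

theorem isSymmBilinField_coneMetric : IsSymmBilinField (coneModel n) (coneMetric g) where
  symm p u v := by
    unfold coneMetric
    rw [g.symm]; ring
  add_left p u v w := by
    simp only [coneMetric, dirDeriv_eq_mvfderiv, map_add, add_apply]
    ring
  smul_left p c u w := by
    simp only [coneMetric, dirDeriv_eq_mvfderiv, map_smul, smul_apply,
      smul_eq_mul]
    ring

theorem coneMetric_apply_eq (p : Cone S) (u v : TangentSpace (coneModel n) p) :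
    coneMetric g p u v = (u : ℝ × EuclideanSpace ℝ (Fin (2 * n + 1))).1 *
      (v : ℝ × EuclideanSpace ℝ (Fin (2 * n + 1))).1 + (radius p) ^ 2 *
        g.inner p.2 (u : ℝ × EuclideanSpace ℝ (Fin (2 * n + 1))).2
          (v : ℝ × EuclideanSpace ℝ (Fin (2 * n + 1))).2 := by
  simp only [coneMetric, dirDeriv_radius, mfderiv_cone_snd]

theorem coneMetric_pos {p : Cone S} {u : TangentSpace (coneModel n) p} (hu : u ≠ 0) :
    0 < coneMetric g p u u := by
  rw [coneMetric_apply_eq]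
  have hr : 0 < radius p := p.1.2
  by_cases h2 : (u : ℝ × EuclideanSpace ℝ (Fin (2 * n + 1))).2 = 0
  · have h1 : (u : ℝ × EuclideanSpace ℝ (Fin (2 * n + 1))).1 ≠ 0 :=
      fun h1 ↦ hu (Prod.ext h1 h2)
    have h3 : g.inner p.2 (u : ℝ × EuclideanSpace ℝ (Fin (2 * n + 1))).2 = 0 := by
      rw [h2]; exact map_zero (g.inner p.2)
    rw [h3]
    have := mul_self_pos.2 h1
    have h4 : (0 : TangentSpace (baseModel n) p.2 →L[ℝ] ℝ)
      (u : ℝ × EuclideanSpace ℝ (Fin (2 * n + 1))).2 = 0 := rfl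
    rw [h4]; linarith
  · have := g.pos p.2 _ h2
    have := mul_self_nonneg (u : ℝ × EuclideanSpace ℝ (Fin (2 * n + 1))).1
    positivity

theorem coneMetric_eulerField (p : Cone S) (v : TangentSpace (coneModel n) p) :
    coneMetric g p (eulerField p) v = radius p * dirDeriv (coneModel n) radius p v := by
  unfold coneMetric
  rw [dirDeriv_radius p (eulerField p), mfderiv_cone_snd p (eulerField p)]
  have : g.inner p.2 (0 : EuclideanSpace ℝ (Fin (2 * n + 1))) = 0 := map_zero (g.inner p.2)
  simp only [eulerField]
  rw [this]
  have h4 : (0 : TangentSpace (baseModel n) p.2 →L[ℝ] ℝ)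
      (mfderiv (coneModel n) (baseModel n) Prod.snd p v) = 0 := rfl
  rw [h4]; ring

theorem mdifferentiableAt_coneMetric {X Y : ∀ q : Cone S, TangentSpace (coneModel n) q}
    {p : Cone S} (hX : SmoothFieldAt (coneModel n) X p) (hY : SmoothFieldAt (coneModel n) Y p) :
    MDifferentiableAt (coneModel n) 𝓘(ℝ, ℝ) (fun q ↦ coneMetric g q (X q) (Y q)) p := by
  have h1 : ∀ {Z : ∀ q : Cone S, TangentSpace (coneModel n) q},
      SmoothFieldAt (coneModel n) Z p → MDifferentiableAt (coneModel n) 𝓘(ℝ, ℝ)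
        (fun q ↦ dirDeriv (coneModel n) radius q (Z q)) p := fun hZ ↦
    mdifferentiableAt_mvfderiv_apply (contMDiff_radius p) hZ
  have h2 : ∀ {Z : ∀ q : Cone S, TangentSpace (coneModel n) q},
      SmoothFieldAt (coneModel n) Z p → ContMDiffAt (coneModel n) (baseModel n).tangent ∞
        (fun q ↦ (⟨q.2, mfderiv (coneModel n) (baseModel n) Prod.snd q (Z q)⟩ :
          TangentBundle (baseModel n) S)) p := fun {Z} hZ ↦
    ((contMDiff_snd (n := ∞) (I := 𝓘(ℝ, ℝ)) (J := baseModel n) (M := posReal)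
      (N := S)).contMDiff_tangentMap (m := ∞) (by simp)).contMDiffAt.comp p hZ
  have h3 : ContMDiffAt (coneModel n) 𝓘(ℝ, ℝ) ∞ (fun q ↦
      g.inner q.2 (mfderiv (coneModel n) (baseModel n) Prod.snd q (X q))
        (mfderiv (coneModel n) (baseModel n) Prod.snd q (Y q))) p := by
    have h4 := g.contMDiff.contMDiffAt.comp p
      ((contMDiff_snd (n := ∞) (I := 𝓘(ℝ, ℝ)) (J := baseModel n) (M := posReal)
      (N := S)) p)
    have := ContMDiffAt.clm_bundle_apply₂ (F₁ := EuclideanSpace ℝ (Fin (2 * n + 1)))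
      (F₂ := EuclideanSpace ℝ (Fin (2 * n + 1))) (F₃ := ℝ) (b := fun q : Cone S ↦ q.2)
      (E₁ := fun x : S ↦ TangentSpace (baseModel n) x)
      (E₂ := fun x : S ↦ TangentSpace (baseModel n) x) (E₃ := Bundle.Trivial S ℝ)
      h4 (h2 hX) (h2 hY)
    simp only [contMDiffAt_totalSpace] at this
    exact this.2
  exact ((h1 hX).mul (h1 hY)).add ((((contMDiff_radius p).mdifferentiableAt (by simp)).pow 2).mul
    (h3.mdifferentiableAt (by simp)))

end ConeMetric

/-! ### The Euler field is homothetic -/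

section EulerBracket

theorem ray_zero {S : Type*} (p : Cone S) : ray p 0 = p := by
  refine Prod.ext (Subtype.ext ?_) rfl
  change Real.exp 0 * (p.1 : ℝ) = p.1
  simp

variable {n : ℕ} {S : Type*} [TopologicalSpace S]
  [ChartedSpace (EuclideanSpace ℝ (Fin (2 * n + 1))) S]

theorem hasDerivAt_comp_ray {F : Type*} [NormedAddCommGroup F] [NormedSpace ℝ F]
    {k : Cone S → F} {p : Cone S} (hk : MDifferentiableAt (coneModel n) 𝓘(ℝ, F) k p) :
    HasDerivAt (fun t ↦ k (ray p t)) (mvfderiv (coneModel n) k p (eulerField p)) 0 := by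
  have h1 := isMIntegralCurve_ray (n := n) p 0
  have h2 : HasMFDerivAt (coneModel n) 𝓘(ℝ, F) k (ray p 0)
      (mfderiv (coneModel n) 𝓘(ℝ, F) k (ray p 0)) := by
    rw [ray_zero]; exact hk.hasMFDerivAt
  have h4 : mfderiv (coneModel n) 𝓘(ℝ, F) k (ray p 0)
      ((1 : ℝ) • eulerField (n := n) (ray p 0)) = mfderiv (coneModel n) 𝓘(ℝ, F) k (ray p 0)
        (eulerField (n := n) (ray p 0)) := congrArg _ (one_smul ℝ _)
  have h5 : ∀ q, q = p → (mfderiv (coneModel n) 𝓘(ℝ, F) k q (eulerField (n := n) q) : F) =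
    mvfderiv (coneModel n) k p (eulerField p) := by rintro q rfl; rfl
  obtain ⟨L, hL, h3⟩ : ∃ L : ℝ →L[ℝ] F, L 1 = mvfderiv (coneModel n) k p (eulerField p) ∧
      HasFDerivAt (fun t ↦ k (ray p t)) L 0 :=
    ⟨_, h4.trans (h5 _ (ray_zero p)), hasMFDerivAt_iff_hasFDerivAt.1 (h2.comp 0 h1)⟩
  rw [← hL]
  exact h3.hasDerivAt

variable [IsManifold (baseModel n) ∞ S]

/-- Along a ray, the radial component of `Z` has derivative `dr[R, Z] + dr Z` for the Euler
field `R`. -/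
theorem hasDerivAt_radial {Z : ∀ q : Cone S, TangentSpace (coneModel n) q} {p : Cone S}
    (hZ : SmoothFieldAt (coneModel n) Z p) :
    HasDerivAt (fun t ↦ dirDeriv (coneModel n) radius (ray p t) (Z (ray p t)))
      (dirDeriv (coneModel n) radius p (VectorField.mlieBracket (coneModel n) eulerField Z p)
        + dirDeriv (coneModel n) radius p (Z p)) 0 := by
  have h1 := mvfderiv_mlieBracket (contMDiff_radius p) (contMDiff_eulerField p) hZ
  have h2 := hasDerivAt_comp_ray (mdifferentiableAt_mvfderiv_apply (contMDiff_radius p) hZ)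
  convert! h2 using 1
  have h3 : (fun q ↦ mvfderiv (coneModel n) radius q (eulerField q)) = (radius : Cone S → ℝ) := by
    funext q
    exact dirDeriv_radius q (eulerField q)
  rw [h3] at h1
  rw [dirDeriv_eq_mvfderiv, dirDeriv_eq_mvfderiv, h1]
  ring

/-- Along a ray, the component of `Z` tangent to `S` is a curve in a fixed tangent space of `S`,
and its derivative is the component of `[R, Z]` for the Euler field `R`. -/
theorem hasDerivAt_tangential {Z : ∀ q : Cone S, TangentSpace (coneModel n) q} {p : Cone S}
    (hZ : SmoothFieldAt (coneModel n) Z p) :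
    HasDerivAt (F := EuclideanSpace ℝ (Fin (2 * n + 1)))
      (fun t ↦ mfderiv (coneModel n) (baseModel n) Prod.snd (ray p t) (Z (ray p t)))
      (mfderiv (coneModel n) (baseModel n) Prod.snd p
        (VectorField.mlieBracket (coneModel n) eulerField Z p)) 0 := by
  set ψ := extChartAt (baseModel n) p.2
  have hψ : ContMDiffAt (coneModel n) 𝓘(ℝ, EuclideanSpace ℝ (Fin (2 * n + 1))) ∞
      (ψ ∘ (Prod.snd : Cone S → S)) p :=
    (contMDiffAt_extChartAt (n := ∞)).comp p contMDiffAt_snd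
  -- on the fibre through `p`, the differential of `ψ ∘ snd` is the projection to `TS`
  have hcomp : ∀ q : Cone S, q.2 ∈ ψ.source → ∀ v : TangentSpace (coneModel n) q,
      mvfderiv (coneModel n) (ψ ∘ Prod.snd) q v =
        mfderiv (baseModel n) 𝓘(ℝ, EuclideanSpace ℝ (Fin (2 * n + 1))) ψ q.2
          (mfderiv (coneModel n) (baseModel n) Prod.snd q v) := fun q hq v ↦
    mfderiv_comp_apply q (mdifferentiableAt_extChartAt (by simpa [ψ] using hq))
      mdifferentiableAt_snd v
  have hid : ∀ v : TangentSpace (baseModel n) p.2,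
      mfderiv (baseModel n) 𝓘(ℝ, EuclideanSpace ℝ (Fin (2 * n + 1))) ψ p.2 v = v := fun v ↦ by
    have := mfderiv_extChartAt_self (I := baseModel n) (x := p.2)
    exact congrArg (fun L ↦ L v) this
  have h1 := mvfderiv_mlieBracket hψ (contMDiff_eulerField p) hZ
  have h2 := hasDerivAt_comp_ray (mdifferentiableAt_mvfderiv_apply hψ hZ)
  -- the Euler field has no component along `S`, so one term of the bracket formula vanishes
  have h3 : (fun q ↦ mvfderiv (coneModel n) (ψ ∘ Prod.snd) q (eulerField q)) =ᶠ[𝓝 p]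
      fun _ ↦ (0 : EuclideanSpace ℝ (Fin (2 * n + 1))) := by
    have hs : ∀ᶠ q : Cone S in 𝓝 p, q.2 ∈ ψ.source :=
      continuousAt_snd.eventually (extChartAt_source_mem_nhds p.2)
    filter_upwards [hs] with q hq
    rw [hcomp q hq, mfderiv_cone_snd]
    exact map_zero _
  have h4 : mvfderiv (coneModel n)
      (fun q ↦ mvfderiv (coneModel n) (ψ ∘ Prod.snd) q (eulerField q)) p (Z p) = 0 := by
    have : mfderiv (coneModel n) 𝓘(ℝ, EuclideanSpace ℝ (Fin (2 * n + 1)))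
      (fun q ↦ mvfderiv (coneModel n) (ψ ∘ Prod.snd) q (eulerField q)) p (Z p) = 0 := by
      rw [h3.mfderiv_eq, mfderiv_const]; rfl
    exact this
  rw [h4, sub_zero] at h1
  have h5 : (mfderiv (coneModel n) (baseModel n) Prod.snd p
        (VectorField.mlieBracket (coneModel n) eulerField Z p) :
          EuclideanSpace ℝ (Fin (2 * n + 1))) =
      mvfderiv (coneModel n) (fun q ↦ mvfderiv (coneModel n) (ψ ∘ Prod.snd) q (Z q)) p
        (eulerField p) := by
    rw [← h1, hcomp p (mem_extChartAt_source p.2)]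
    exact (hid _).symm
  rw [h5]
  have h6 : (fun t ↦ (mfderiv (coneModel n) (baseModel n) Prod.snd (ray p t) (Z (ray p t)) :
      EuclideanSpace ℝ (Fin (2 * n + 1)))) =
      fun t ↦ mvfderiv (coneModel n) (ψ ∘ Prod.snd) (ray p t) (Z (ray p t)) := by
    funext t
    rw [hcomp (ray p t) (mem_extChartAt_source p.2)]
    exact (hid _).symm
  rw [h6]
  exact h2

variable (g : ContMDiffRiemannianMetric (baseModel n) ∞ (EuclideanSpace ℝ (Fin (2 * n + 1)))
      (fun x : S ↦ TangentSpace (baseModel n) x))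

/-- The Euler field `R` is homothetic: `ℒ_R h = 2 h` for the cone metric `h`. -/
theorem lieDerivative_eulerField_coneMetric {X Z : ∀ q : Cone S, TangentSpace (coneModel n) q}
    {p : Cone S} (hX : SmoothFieldAt (coneModel n) X p) (hZ : SmoothFieldAt (coneModel n) Z p) :
    dirDeriv (coneModel n) (fun q ↦ coneMetric g q (X q) (Z q)) p (eulerField p)
      - coneMetric g p (VectorField.mlieBracket (coneModel n) eulerField X p) (Z p)
      - coneMetric g p (X p) (VectorField.mlieBracket (coneModel n) eulerField Z p)
      = 2 * coneMetric g p (X p) (Z p) := by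
  have h0 := hasDerivAt_comp_ray (mdifferentiableAt_coneMetric g hX hZ)
  have X1 := hasDerivAt_radial hX
  have Z1 := hasDerivAt_radial hZ
  have X2 := hasDerivAt_tangential hX
  have Z2 := hasDerivAt_tangential hZ
  set G : EuclideanSpace ℝ (Fin (2 * n + 1)) →L[ℝ] EuclideanSpace ℝ (Fin (2 * n + 1)) →L[ℝ] ℝ :=
    g.inner p.2
  have hr : HasDerivAt (fun t ↦ radius (ray p t)) (radius p) 0 := by
    have := (Real.hasDerivAt_exp 0).mul_const (p.1 : ℝ)
    rw [Real.exp_zero, one_mul] at this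
    exact this
  have hG := (G.hasFDerivAt.comp_hasDerivAt (0 : ℝ) X2).clm_apply Z2
  have h1 := (X1.mul Z1).add ((hr.pow 2).mul hG)
  have h2 := h0.unique h1
  have hX0 := congrArg (fun q ↦ dirDeriv (coneModel n) radius q (X q)) (ray_zero p)
  have hZ0 := congrArg (fun q ↦ dirDeriv (coneModel n) radius q (Z q)) (ray_zero p)
  have hX0' := congrArg (fun q ↦ (mfderiv (coneModel n) (baseModel n) Prod.snd q (X q) :
    EuclideanSpace ℝ (Fin (2 * n + 1)))) (ray_zero p)
  have hZ0' := congrArg (fun q ↦ (mfderiv (coneModel n) (baseModel n) Prod.snd q (Z q) :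
    EuclideanSpace ℝ (Fin (2 * n + 1)))) (ray_zero p)
  have hr0 := congrArg radius (ray_zero p)
  rw [dirDeriv_eq_mvfderiv, h2]
  simp only [Function.comp, Pi.pow_apply] at hX0 hZ0 hX0' hZ0' ⊢
  simp only [hX0, hZ0, hX0', hZ0', hr0]
  unfold coneMetric
  have key : ∀ a a' b b' r u v w : ℝ, (a' + a) * b + a * (b' + b)
      + (((2 : ℕ) : ℝ) * r ^ (2 - 1) * r * u + r ^ 2 * (v + w))
      - (a' * b + r ^ 2 * v) - (a * b' + r ^ 2 * w) = 2 * (a * b + r ^ 2 * u) := by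
    intros; push_cast; ring
  exact key _ _ _ _ _ _ _ _

end EulerBracket

/-! ### Pullback of vector fields by a diffeomorphism -/

section DiffeomorphPullback

variable {E : Type*} [NormedAddCommGroup E] [NormedSpace ℝ E]
  {H : Type*} [TopologicalSpace H] {I : ModelWithCorners ℝ E H}
  {M : Type*} [TopologicalSpace M] [ChartedSpace H M]

theorem Diffeomorph.isInvertible_mfderiv (τ : M ≃ₘ^∞⟮I, I⟯ M) (q : M) :
    (mfderiv I I τ q).IsInvertible :=
  ⟨τ.mfderivToContinuousLinearEquiv (by simp) q, rfl⟩

theorem Diffeomorph.mfderiv_mpullback (τ : M ≃ₘ^∞⟮I, I⟯ M) (U : ∀ q : M, TangentSpace I q)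
    (q : M) : mfderiv I I τ q (VectorField.mpullback I I τ U q) = U (τ q) :=
  (τ.isInvertible_mfderiv q).self_apply_inverse _

theorem Diffeomorph.mpullback_apply_mfderiv (τ : M ≃ₘ^∞⟮I, I⟯ M) {U : ∀ q : M, TangentSpace I q}
    {q : M} {u : TangentSpace I q} (h : U (τ q) = mfderiv I I τ q u) :
    VectorField.mpullback I I τ U q = u := by
  rw [VectorField.mpullback_apply, h]
  exact (τ.isInvertible_mfderiv q).inverse_apply_self _

variable [IsManifold I ∞ M]

theorem Diffeomorph.smoothFieldAt_mpullback [CompleteSpace E] (τ : M ≃ₘ^∞⟮I, I⟯ M)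
    {U : ∀ q : M, TangentSpace I q} {q : M} (hU : SmoothFieldAt I U (τ q)) :
    SmoothFieldAt I (VectorField.mpullback I I τ U) q :=
  ContMDiffAt.mpullback_vectorField_preimage (n := ∞) hU τ.contMDiff.contMDiffAt
    (τ.isInvertible_mfderiv q) (by simp)

theorem Diffeomorph.mfderiv_mlieBracket_mpullback [CompleteSpace E] (τ : M ≃ₘ^∞⟮I, I⟯ M)
    {U V : ∀ q : M, TangentSpace I q} {q : M} (hU : SmoothFieldAt I U (τ q))
    (hV : SmoothFieldAt I V (τ q)) :
    mfderiv I I τ q (VectorField.mlieBracket I (VectorField.mpullback I I τ U)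
      (VectorField.mpullback I I τ V) q) = VectorField.mlieBracket I U V (τ q) := by
  have : IsManifold I (minSmoothness ℝ 3) M := by
    rw [minSmoothness_of_isRCLikeNormedField]
    exact IsManifold.of_le (n := ∞) (by norm_cast)
  rw [← VectorField.mpullback_mlieBracket (n := ∞) hU.mdifferentiableAt hV.mdifferentiableAt
    τ.contMDiff.contMDiffAt (by rw [minSmoothness_of_isRCLikeNormedField]; norm_cast)]
  exact τ.mfderiv_mpullback _ _

end DiffeomorphPullback

/-! ### Anti-holomorphic involutions of the cone preserving the radius -/

section Radius

variable {n : ℕ} {S : Type*} [TopologicalSpace S]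
  [ChartedSpace (EuclideanSpace ℝ (Fin (2 * n + 1))) S]

theorem dirDeriv_radius_mfderiv {τ : Cone S ≃ₘ^∞⟮coneModel n, coneModel n⟯ Cone S}
    (hr : ∀ p : Cone S, radius (τ p) = radius p) (p : Cone S) (v : TangentSpace (coneModel n) p) :
    dirDeriv (coneModel n) radius (τ p) (mfderiv (coneModel n) (coneModel n) τ p v) =
      dirDeriv (coneModel n) radius p v := by
  rw [← dirDeriv_comp ((contMDiff_radius (τ p)).mdifferentiableAt (by simp))
    (τ.contMDiff.mdifferentiableAt (by simp))]
  simp only [hr]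

end Radius

section Sasaki

variable {n : ℕ} {S : Type*} [TopologicalSpace S]
  [ChartedSpace (EuclideanSpace ℝ (Fin (2 * n + 1))) S] [IsManifold (baseModel n) ∞ S]
  (g : ContMDiffRiemannianMetric (baseModel n) ∞ (EuclideanSpace ℝ (Fin (2 * n + 1)))
      (fun x : S ↦ TangentSpace (baseModel n) x))
  {J : ∀ p : Cone S, TangentSpace (coneModel n) p →L[ℝ] TangentSpace (coneModel n) p}

/-- `∇_X R = X` for the Euler field `R` of the cone, in Koszul form. -/
theorem koszul_eulerField {X Z : ∀ q : Cone S, TangentSpace (coneModel n) q} {p : Cone S}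
    (hX : SmoothFieldAt (coneModel n) X p) (hZ : SmoothFieldAt (coneModel n) Z p) :
    koszul (coneModel n) (coneMetric g) X eulerField Z p = 2 * coneMetric g p (X p) (Z p) := by
  have hh := isSymmBilinField_coneMetric g
  have hL := lieDerivative_eulerField_coneMetric g hX hZ
  have hrad : ∀ {Y : ∀ q : Cone S, TangentSpace (coneModel n) q},
      SmoothFieldAt (coneModel n) Y p → ∀ v : TangentSpace (coneModel n) p,
      dirDeriv (coneModel n) (fun q ↦ coneMetric g q (eulerField q) (Y q)) p v =
        radius p * dirDeriv (coneModel n) (fun q ↦ dirDeriv (coneModel n) radius q (Y q)) p v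
          + dirDeriv (coneModel n) radius p (Y p) * dirDeriv (coneModel n) radius p v := by
    intro Y hY v
    simp only [coneMetric_eulerField]
    exact dirDeriv_mul ((contMDiff_radius p).mdifferentiableAt (by simp))
      (mdifferentiableAt_mvfderiv_apply (contMDiff_radius p) hY) v
  have hbr : dirDeriv (coneModel n) radius p (VectorField.mlieBracket (coneModel n) Z X p) =
      dirDeriv (coneModel n) (fun q ↦ dirDeriv (coneModel n) radius q (X q)) p (Z p)
       - dirDeriv (coneModel n) (fun q ↦ dirDeriv (coneModel n) radius q (Z q)) p (X p) :=
    mvfderiv_mlieBracket (contMDiff_radius p) hZ hX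
  unfold koszul
  simp only [hh.symm _ (X _) (eulerField _), hh.symm _ (Z _) (X _)]
  rw [hrad hX, hrad hZ, VectorField.mlieBracket_swap_apply (V := X) (W := eulerField),
    hh.neg_left, hh.symm p _ (eulerField p), coneMetric_eulerField, hbr,
    hh.symm p _ (X p)]
  linear_combination hL

variable (hJ : IsSasaki g J)
include hJ

theorem smoothFieldAt_reebField (p : Cone S) :
    SmoothFieldAt (coneModel n) (fun q ↦ J q (eulerField q)) p :=
  hJ.complex.smoothFieldAt_apply (contMDiff_eulerField p)

/-- The Kähler form is exact on the cone: `2ω = dθ` for the 1-form `θ = h(JR, ·)`, where `R` is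
the Euler field. -/
theorem two_mul_fundamentalForm {X Z : ∀ q : Cone S, TangentSpace (coneModel n) q} {p : Cone S}
    (hX : SmoothFieldAt (coneModel n) X p) (hZ : SmoothFieldAt (coneModel n) Z p) :
    2 * fundamentalForm (coneModel n) (coneMetric g) J p (X p) (Z p) =
      dirDeriv (coneModel n) (fun q ↦ coneMetric g q (J q (eulerField q)) (Z q)) p (X p)
        - dirDeriv (coneModel n) (fun q ↦ coneMetric g q (J q (eulerField q)) (X q)) p (Z p)
        - coneMetric g p (J p (eulerField p)) (VectorField.mlieBracket (coneModel n) X Z p) := by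
  have hh := isSymmBilinField_coneMetric g
  have hR := contMDiff_eulerField (n := n) p
  have hK : IsKahler (coneModel n) (coneMetric g) J := hJ
  have h1 := hK.koszul_add hh hX hR hZ
  have h2 := hK.koszul_add hh hZ hR hX
  rw [koszul_eulerField g hX (hJ.complex.smoothFieldAt_apply hZ)] at h1
  rw [koszul_eulerField g hZ (hJ.complex.smoothFieldAt_apply hX)] at h2
  have h3 := koszul_sub_koszul_swap hh X (fun q ↦ J q (eulerField q)) Z p
  have h4 : coneMetric g p (X p) (J p (Z p)) = - coneMetric g p (J p (X p)) (Z p) := by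
    rw [← hK.hermitian p (X p) (J p (Z p)), hK.complex.sq_eq_neg, hh.neg_right]
  have h5 : coneMetric g p (Z p) (J p (X p)) = coneMetric g p (J p (X p)) (Z p) := hh.symm _ _ _
  unfold fundamentalForm
  rw [h4] at h1
  rw [h5] at h2
  linarith

/-- The 1-form `θ = h(JR, ·)` is `-r dr ∘ J`. -/
theorem coneMetric_reebField (p : Cone S) (v : TangentSpace (coneModel n) p) :
    coneMetric g p (J p (eulerField p)) v =
      -(radius p * dirDeriv (coneModel n) radius p (J p v)) := by
  have hh := isSymmBilinField_coneMetric g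
  rw [← coneMetric_eulerField g, ← hJ.hermitian p (eulerField p) (J p v), hJ.complex.sq_eq_neg,
    hh.neg_right, neg_neg]

variable {τ : Cone S ≃ₘ^∞⟮coneModel n, coneModel n⟯ Cone S}
  (hτ : IsAntiholomorphicInvolution (coneModel n) J τ) (hr : ∀ p : Cone S, radius (τ p) = radius p)
include hτ hr

/-- `τ^* θ = -θ`: the map `τ` preserves `r dr` and anticommutes with `J`. -/
theorem reebForm_mfderiv (p : Cone S) (v : TangentSpace (coneModel n) p) :
    coneMetric g (τ p) (J (τ p) (eulerField (τ p)))
        (mfderiv (coneModel n) (coneModel n) τ p v) =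
      -coneMetric g p (J p (eulerField p)) v := by
  rw [coneMetric_reebField g hJ, coneMetric_reebField g hJ, hr,
    ← dirDeriv_radius_mfderiv hr p (J p v), hτ.antiholomorphic]
  simp only [dirDeriv_eq_mvfderiv, map_neg]
  ring

/-- `τ^* ω = -ω`, because `2ω = dθ` and `θ = - r dr ∘ J` changes sign under `τ`. -/
theorem fundamentalForm_mfderiv (p : Cone S) (u v : TangentSpace (coneModel n) p) :
    fundamentalForm (coneModel n) (coneMetric g) J (τ p)
      (mfderiv (coneModel n) (coneModel n) τ p u) (mfderiv (coneModel n) (coneModel n) τ p v) =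
      -fundamentalForm (coneModel n) (coneMetric g) J p u v := by
  set U := FiberBundle.extend (ℝ × EuclideanSpace ℝ (Fin (2 * n + 1)))
    (mfderiv (coneModel n) (coneModel n) τ p u)
  set V := FiberBundle.extend (ℝ × EuclideanSpace ℝ (Fin (2 * n + 1)))
    (mfderiv (coneModel n) (coneModel n) τ p v)
  have hU : SmoothFieldAt (coneModel n) U (τ p) := smoothFieldAt_extend _
  have hV : SmoothFieldAt (coneModel n) V (τ p) := smoothFieldAt_extend _
  have hU0 : U (τ p) = mfderiv (coneModel n) (coneModel n) τ p u :=
    FiberBundle.extend_apply_self _ _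
  have hV0 : V (τ p) = mfderiv (coneModel n) (coneModel n) τ p v :=
    FiberBundle.extend_apply_self _ _
  have h1 := two_mul_fundamentalForm g hJ hU hV
  have h2 := two_mul_fundamentalForm g hJ (τ.smoothFieldAt_mpullback hU)
    (τ.smoothFieldAt_mpullback hV)
  rw [τ.mpullback_apply_mfderiv hU0, τ.mpullback_apply_mfderiv hV0] at h2
  have hθ : ∀ {W : ∀ q : Cone S, TangentSpace (coneModel n) q},
      SmoothFieldAt (coneModel n) W (τ p) → ∀ w : TangentSpace (coneModel n) p,
      dirDeriv (coneModel n) (fun q ↦ coneMetric g q (J q (eulerField q))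
        (VectorField.mpullback (coneModel n) (coneModel n) τ W q)) p w =
      -dirDeriv (coneModel n) (fun q ↦ coneMetric g q (J q (eulerField q)) (W q)) (τ p)
        (mfderiv (coneModel n) (coneModel n) τ p w) := by
    intro W hW w
    rw [← dirDeriv_comp (mdifferentiableAt_coneMetric g (smoothFieldAt_reebField g hJ _) hW)
      (τ.contMDiff.mdifferentiableAt (by simp)), ← dirDeriv_neg]
    congr 1
    funext q
    rw [← τ.mfderiv_mpullback W q, reebForm_mfderiv g hJ hτ hr, neg_neg]
  have h3 := reebForm_mfderiv g hJ hτ hr p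
    (VectorField.mlieBracket (coneModel n) (VectorField.mpullback (coneModel n) (coneModel n) τ U)
      (VectorField.mpullback (coneModel n) (coneModel n) τ V) p)
  rw [τ.mfderiv_mlieBracket_mpullback hU hV] at h3
  rw [hθ hU, hθ hV, ← hU0, ← hV0] at h2
  rw [← hU0, ← hV0]
  linarith

/-- `τ` is an isometry of the cone metric. -/
theorem coneMetric_mfderiv (p : Cone S) (u v : TangentSpace (coneModel n) p) :
    coneMetric g (τ p) (mfderiv (coneModel n) (coneModel n) τ p u)
      (mfderiv (coneModel n) (coneModel n) τ p v) = coneMetric g p u v := by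
  have hh := isSymmBilinField_coneMetric g
  have h := fundamentalForm_mfderiv g hJ hτ hr p (J p u) v
  unfold fundamentalForm at h
  rw [hτ.antiholomorphic, map_neg, hJ.complex.sq_eq_neg, neg_neg, hJ.complex.sq_eq_neg,
    hh.neg_left, neg_neg] at h
  exact h

/-- `τ` preserves the Euler field, the gradient of `r² / 2`. -/
theorem mfderiv_eulerField (p : Cone S) :
    mfderiv (coneModel n) (coneModel n) τ p (eulerField p) = eulerField (τ p) := by
  have hh := isSymmBilinField_coneMetric g
  have key : ∀ w, coneMetric g (τ p)
      (mfderiv (coneModel n) (coneModel n) τ p (eulerField p) - eulerField (τ p)) w = 0 := by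
    intro w
    obtain ⟨v, rfl⟩ : ∃ v, mfderiv (coneModel n) (coneModel n) τ p v = w :=
      ⟨_, (τ.isInvertible_mfderiv p).self_apply_inverse w⟩
    rw [hh.sub_left, coneMetric_mfderiv g hJ hτ hr, coneMetric_eulerField, coneMetric_eulerField,
      hr, dirDeriv_radius_mfderiv hr, sub_self]
  by_contra hne
  exact (coneMetric_pos g (sub_ne_zero.2 hne)).ne' (key _)

/-- `τ` commutes with the flow of the Euler field. -/
theorem map_ray [T2Space S] (p : Cone S) (t : ℝ) : τ (ray p t) = ray (τ p) t := by
  have h1 : IsMIntegralCurve (I := coneModel n) (fun t ↦ τ (ray p t)) eulerField := by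
    intro t
    have h := (τ.contMDiff.mdifferentiableAt (by simp) (x := ray p t)).hasMFDerivAt.comp t
      (isMIntegralCurve_ray p t)
    have e : (mfderiv (coneModel n) (coneModel n) τ (ray p t) :
        ℝ × EuclideanSpace ℝ (Fin (2 * n + 1)) →L[ℝ] ℝ × EuclideanSpace ℝ (Fin (2 * n + 1))).comp
          ((1 : ℝ →L[ℝ] ℝ).smulRight
            (eulerField (n := n) (ray p t) : ℝ × EuclideanSpace ℝ (Fin (2 * n + 1)))) =
        (1 : ℝ →L[ℝ] ℝ).smulRight
          (eulerField (n := n) (τ (ray p t)) : ℝ × EuclideanSpace ℝ (Fin (2 * n + 1))) := by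
      rw [← mfderiv_eulerField g hJ hτ hr]
      exact ContinuousLinearMap.ext fun s ↦ map_smul (mfderiv (coneModel n) (coneModel n) τ
        (ray p t)) s (eulerField (ray p t))
    exact e ▸ h
  have : IsManifold (coneModel n) 1 (Cone S) := IsManifold.of_le (n := ∞) (by simp)
  refine congrFun (isMIntegralCurve_Ioo_eq_of_contMDiff_boundaryless (t₀ := 0)
    ((contMDiff_eulerField (n := n)).of_le (by simp)) h1 (isMIntegralCurve_ray (τ p)) ?_) t
  simp only [ray_zero]

end Sasaki

/-! ### Charts from the inverse function theorem -/

section InverseFunction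

variable {E : Type*} [NormedAddCommGroup E] [NormedSpace ℝ E] [CompleteSpace E]
  {H : Type*} [TopologicalSpace H] {I : ModelWithCorners ℝ E H} [I.Boundaryless]
  {M : Type*} [TopologicalSpace M] [ChartedSpace H M] [IsManifold I ∞ M]

/-- The inverse function theorem: a smooth map to the model vector space whose differential at `p`
is invertible is a chart near `p`. -/
theorem exists_chart_of_isInvertible_mfderiv {F : M → E} {p : M}
    (hF : ∀ᶠ q in 𝓝 p, ContMDiffAt I 𝓘(ℝ, E) ∞ F q)
    (hF' : (mfderiv I 𝓘(ℝ, E) F p).IsInvertible) :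
    ∃ φ ∈ IsManifold.maximalAtlas I ∞ M, p ∈ φ.source ∧ ∀ q ∈ φ.source, φ.extend I q = F q := by
  set ψ := extChartAt I p
  set k : E → E := F ∘ ψ.symm
  have hψs : ∀ {y}, y ∈ ψ.target → ContMDiffAt 𝓘(ℝ, E) I ∞ ψ.symm y := fun hy ↦
    (contMDiffOn_extChartAt_symm p).contMDiffAt ((isOpen_extChartAt_target p).mem_nhds hy)
  have hk : ∀ {q}, q ∈ ψ.source → ContMDiffAt I 𝓘(ℝ, E) ∞ F q → ContDiffAt ℝ ∞ k (ψ q) := by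
    intro q hq hFq
    refine ContMDiffAt.contDiffAt (ContMDiffAt.comp (I' := I) _ ?_ (hψs (ψ.map_source hq)))
    rwa [ψ.left_inv hq]
  have hp : p ∈ ψ.source := mem_extChartAt_source p
  have hkp := hk hp hF.self_of_nhds
  obtain ⟨k', hk'⟩ : ∃ k' : E ≃L[ℝ] E, HasFDerivAt k (k' : E →L[ℝ] E) (ψ p) := by
    have h2 : MDifferentiableAt I 𝓘(ℝ, E) F (ψ.symm (ψ p)) := by
      rw [ψ.left_inv hp]; exact hF.self_of_nhds.mdifferentiableAt (by simp)
    have h3 := mfderiv_comp (ψ p) h2 ((hψs (ψ.map_source hp)).mdifferentiableAt (by simp))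
    have h4 : (mfderiv I 𝓘(ℝ, E) F (ψ.symm (ψ p))).IsInvertible := by
      rw [ψ.left_inv hp]; exact hF'
    have h5 : (mfderiv 𝓘(ℝ, E) I ψ.symm (ψ p)).IsInvertible := by
      have := isInvertible_mfderivWithin_extChartAt_symm (I := I) (ψ.map_source hp)
      rwa [I.range_eq_univ, mfderivWithin_univ] at this
    have h6 : (fderiv ℝ k (ψ p)).IsInvertible := by
      rw [← mfderiv_eq_fderiv]
      exact h3 ▸ h4.comp h5
    obtain ⟨k', hk'⟩ := h6
    exact ⟨k', hk' ▸ (hkp.differentiableAt (by simp)).hasFDerivAt⟩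
  set e := hkp.toOpenPartialHomeomorph k hk' (by simp)
  -- the inverse of `e` is smooth where the derivative of `k` is invertible, an open condition
  have hfd : ∀ᶠ y in 𝓝 (ψ p), fderiv ℝ k y ∈ range ((↑) : (E ≃L[ℝ] E) → E →L[ℝ] E) := by
    have hc : ContinuousAt (fderiv ℝ k) (ψ p) :=
      (hkp.fderiv_right (m := 0) (by norm_cast)).continuousAt
    refine hc.eventually (p := fun L ↦ L ∈ range ((↑) : (E ≃L[ℝ] E) → E →L[ℝ] E)) ?_
    rw [hk'.fderiv]
    exact ContinuousLinearEquiv.nhds k'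
  obtain ⟨U, hU, hUo, hpU⟩ := eventually_nhds_iff.1
    ((hF.and (extChartAt_source_mem_nhds (I := I) p)).and
      ((continuousAt_extChartAt p).eventually hfd))
  set φ₀ : OpenPartialHomeomorph M H := ((chartAt H p).trans
    (I.toHomeomorph.toOpenPartialHomeomorph.trans e)).trans
      I.toHomeomorph.symm.toOpenPartialHomeomorph
  have hφ₀ : ∀ q, φ₀ q = I.symm (k (ψ q)) := fun q ↦ rfl
  have hφ₀s : ∀ z, φ₀.symm z = ψ.symm (e.symm (I z)) := fun z ↦ rfl
  have hsrc : ∀ {q}, q ∈ φ₀.source → q ∈ ψ.source ∧ ψ q ∈ e.source := by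
    intro q hq
    simp [φ₀, ψ, mfld_simps] at hq ⊢
    exact hq
  refine ⟨φ₀.restrOpen U hUo, OpenPartialHomeomorph.mem_maximalAtlas_of_contMDiffOn _ ?_ ?_, ?_, ?_⟩
  · rintro q ⟨hq, hqU⟩
    obtain ⟨hqs, -⟩ := hsrc hq
    have h1 : ContMDiffAt 𝓘(ℝ, E) I ∞ I.symm (k (ψ q)) := by
      have := I.contMDiffOn_symm (n := ∞)
      rw [I.range_eq_univ] at this
      exact this.contMDiffAt univ_mem
    have h2 := (hk hqs (hU q hqU).1.1).contMDiffAt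
    have h3 : ContMDiffAt I 𝓘(ℝ, E) ∞ ψ q := contMDiffAt_extChartAt' (by simpa [ψ] using hqs)
    exact (h1.comp q (h2.comp q h3)).contMDiffWithinAt
  · intro z hz
    have hq := (φ₀.restrOpen U hUo).map_target hz
    rw [OpenPartialHomeomorph.restrOpen_source] at hq
    obtain ⟨hq, hqU⟩ := hq
    obtain ⟨hqs, hqe⟩ := hsrc hq
    set q := (φ₀.restrOpen U hUo).symm z
    have hzq : z = I.symm (k (ψ q)) := ((φ₀.restrOpen U hUo).right_inv hz).symm
    have hIz : I z = e (ψ q) := by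
      rw [hzq, I.right_inv (by rw [I.range_eq_univ]; trivial)]; rfl
    have hes : e.symm (I z) = ψ q := by rw [hIz, e.left_inv hqe]
    obtain ⟨L, hL⟩ := (hU q hqU).2
    have hkq := hk hqs (hU q hqU).1.1
    have h1 : ContDiffAt ℝ ∞ e.symm (I z) := by
      refine e.contDiffAt_symm (f₀' := L) ?_ ?_ ?_
      · rw [hIz]; exact e.map_source hqe
      · rw [hes, hL]; exact (hkq.differentiableAt (by simp)).hasFDerivAt
      · rw [hes]; exact hkq
    have h2 : ContMDiffAt 𝓘(ℝ, E) I ∞ ψ.symm (e.symm (I z)) := by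
      rw [hes]; exact hψs (ψ.map_source hqs)
    exact (h2.comp z (h1.contMDiffAt.comp z I.contMDiff.contMDiffAt)).contMDiffWithinAt
  · refine ⟨?_, hpU⟩
    have : ψ p ∈ e.source := hkp.mem_toOpenPartialHomeomorph_source hk' (by simp)
    simp [φ₀, mfld_simps]
    exact this
  · rintro q ⟨hq, -⟩
    change I (I.symm (k (ψ q))) = F q
    rw [I.right_inv (by rw [I.range_eq_univ]; trivial)]
    exact congrArg F (ψ.left_inv (hsrc hq).1)

end InverseFunction

/-! ### Fixed points of smooth involutions -/

/-- In a chart in which `τ` is the linear map `A`, the fixed points of `τ` are those of `A`. -/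
theorem mem_fixedPoints_iff_of_linearizing {E : Type*} [NormedAddCommGroup E]
    [NormedSpace ℝ E] {H : Type*} [TopologicalSpace H] {I : ModelWithCorners ℝ E H}
    {M : Type*} [TopologicalSpace M] {τ : M → M} {φ : OpenPartialHomeomorph M H}
    {A : E →L[ℝ] E}
    (h : ∀ q ∈ φ.source, τ q ∈ φ.source ∧ φ.extend I (τ q) = A (φ.extend I q))
    {q : M} (hq : q ∈ φ.source) :
    q ∈ Function.fixedPoints τ ↔ A (φ.extend I q) = φ.extend I q := by
  rw [← (h q hq).2, Function.mem_fixedPoints, Function.IsFixedPt]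
  refine ⟨fun e ↦ by rw [e], fun e ↦ ?_⟩
  refine (φ.extend I).injOn ?_ ?_ e
  · rw [φ.extend_source]; exact (h q hq).1
  · rwa [φ.extend_source]

section Differential

variable {E : Type*} [NormedAddCommGroup E] [NormedSpace ℝ E]
  {H : Type*} [TopologicalSpace H] (I : ModelWithCorners ℝ E H)
  {M : Type*} [TopologicalSpace M] [ChartedSpace H M]

/-- The differential at `p` of a map of `M` to itself, as an endomorphism of the model vector
space `E`. It is the differential as an endomorphism of `T_pM` when `p` is a fixed point. -/
def modelDeriv (τ : M → M) (p : M) : E →L[ℝ] E := mfderiv I I τ p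

variable {I}

theorem modelDeriv_modelDeriv {τ : M → M} (hτ : MDifferentiable I I τ) (hinv : ∀ q, τ (τ q) = q)
    {p : M} (hp : τ p = p) (v : E) : modelDeriv I τ p (modelDeriv I τ p v) = v := by
  have h1 := mfderiv_comp_apply p (hτ (τ p)) (hτ p) v
  have h2 : τ ∘ τ = id := funext hinv
  have h3 : mfderiv I I (τ ∘ τ) p v = v := by rw [h2, mfderiv_id]; rfl
  have h4 : modelDeriv I τ (τ p) = modelDeriv I τ p := by rw [hp]
  have h5 : modelDeriv I τ (τ p) (modelDeriv I τ p v) = v := h1.symm.trans h3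
  rwa [h4] at h5

end Differential

section Linearization

variable {E : Type*} [NormedAddCommGroup E] [NormedSpace ℝ E] [CompleteSpace E]
  {H : Type*} [TopologicalSpace H] {I : ModelWithCorners ℝ E H} [I.Boundaryless]
  {M : Type*} [TopologicalSpace M] [ChartedSpace H M] [IsManifold I ∞ M]

/-- Near a fixed point `p`, a smooth involution is linear in a suitable chart: if `ψ` is a chart
at `p`, then `(ψ + dτ_p ∘ ψ ∘ τ) / 2` is a chart which intertwines `τ` and `dτ_p`. -/
theorem exists_chart_linearizing_involution {τ : M → M} (hτ : ContMDiff I I ∞ τ)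
    (hinv : ∀ q, τ (τ q) = q) {p : M} (hp : τ p = p) :
    ∃ φ ∈ IsManifold.maximalAtlas I ∞ M, p ∈ φ.source ∧
      HasMFDerivAt I 𝓘(ℝ, E) (φ.extend I) p (ContinuousLinearMap.id ℝ E) ∧
      ∀ q ∈ φ.source, τ q ∈ φ.source ∧
        φ.extend I (τ q) = modelDeriv I τ p (φ.extend I q) := by
  set A := modelDeriv I τ p
  have hAA : ∀ v, A (A v) = v := modelDeriv_modelDeriv (hτ.mdifferentiable (by simp)) hinv hp
  set ψ := extChartAt I p
  set F : M → E := fun q ↦ (1 / 2 : ℝ) • (ψ q + A (ψ (τ q)))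
  -- `F` is the average of `ψ` over the group of order two generated by `τ`
  have hFτ : ∀ q, F (τ q) = A (F q) := fun q ↦ by
    simp only [F, hinv, map_smul, map_add, hAA]
    rw [add_comm]
  have hs : ∀ᶠ q in 𝓝 p, q ∈ (chartAt H p).source :=
    (chartAt H p).open_source.mem_nhds (mem_chart_source H p)
  have hτs : ∀ᶠ q in 𝓝 p, τ q ∈ (chartAt H p).source := by
    refine hτ.continuous.continuousAt.eventually ?_
    rwa [hp]
  have hF : ∀ᶠ q in 𝓝 p, ContMDiffAt I 𝓘(ℝ, E) ∞ F q := by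
    filter_upwards [hs, hτs] with q hq hτq
    have h1 : ContMDiffAt I 𝓘(ℝ, E) ∞ ψ q := contMDiffAt_extChartAt' hq
    have h2 : ContMDiffAt I 𝓘(ℝ, E) ∞ ψ (τ q) := contMDiffAt_extChartAt' hτq
    have h3 : ContMDiffAt I 𝓘(ℝ, E) ∞ (fun q ↦ A (ψ (τ q))) q :=
      A.contMDiff.contMDiffAt.comp q (h2.comp q hτ.contMDiffAt)
    exact ((1 / 2 : ℝ) • ContinuousLinearMap.id ℝ E).contMDiff.contMDiffAt.comp q (h1.add h3)
  have hψ : HasMFDerivAt I 𝓘(ℝ, E) ψ p (ContinuousLinearMap.id ℝ E) := by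
    have h := (mdifferentiableAt_extChartAt (I := I) (mem_chart_source H p)).hasMFDerivAt
    rw [mfderiv_extChartAt_self] at h
    exact h
  have hF' : HasMFDerivAt I 𝓘(ℝ, E) F p (ContinuousLinearMap.id ℝ E) := by
    have hψτ : HasMFDerivAt I 𝓘(ℝ, E) ψ (τ p) (ContinuousLinearMap.id ℝ E) := by rwa [hp]
    have h2 : HasMFDerivAt I 𝓘(ℝ, E) (ψ ∘ τ) p A :=
      hψτ.comp p (hτ.mdifferentiable (by simp) p).hasMFDerivAt
    have h3 : HasMFDerivAt I 𝓘(ℝ, E) (A ∘ ψ ∘ τ) p (A.comp A) := A.hasMFDerivAt.comp p h2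
    have h4 := (hψ.add h3).const_smul (1 / 2 : ℝ)
    have e : (1 / 2 : ℝ) • (ContinuousLinearMap.id ℝ E + A.comp A) =
        ContinuousLinearMap.id ℝ E := by
      ext v
      simp only [smul_apply, add_apply, ContinuousLinearMap.id_apply,
        ContinuousLinearMap.comp_apply, hAA]
      module
    exact e ▸ h4
  obtain ⟨φ, hφ, hpφ, hφF⟩ := exists_chart_of_isInvertible_mfderiv hF
    (by rw [hF'.mfderiv]; exact ⟨ContinuousLinearEquiv.refl ℝ E, rfl⟩)
  have hO : IsOpen (τ ⁻¹' φ.source) := φ.open_source.preimage hτ.continuous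
  refine ⟨φ.restrOpen _ hO, ?_, ⟨hpφ, ?_⟩, ?_, ?_⟩
  · rw [IsManifold.mem_maximalAtlas_iff_contMDiffOn] at hφ ⊢
    exact ⟨hφ.1.mono inter_subset_left, hφ.2.mono inter_subset_left⟩
  · change τ p ∈ φ.source
    rwa [hp]
  · refine HasMFDerivAt.congr_of_eventuallyEq hF' ?_
    filter_upwards [φ.open_source.mem_nhds hpφ] with q hq using hφF q hq
  · rintro q ⟨hq, hτq⟩
    refine ⟨⟨hτq, ?_⟩, ?_⟩
    · change τ (τ q) ∈ φ.source
      rwa [hinv]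
    · exact (hφF _ hτq).trans ((hFτ q).trans (congrArg A (hφF q hq).symm))

/-- The fixed point set of a smooth involution is a submanifold, whose dimension at `p` is the
dimension of the fixed space of the differential at `p`. -/
theorem isSubmanifold_fixedPoints {τ : M → M} (hτ : ContMDiff I I ∞ τ)
    (hinv : ∀ q, τ (τ q) = q) {k : ℕ}
    (hk : ∀ p ∈ Function.fixedPoints τ,
      Module.finrank ℝ (LinearMap.eqLocus (modelDeriv I τ p : E →ₗ[ℝ] E) LinearMap.id) = k) :
    IsSubmanifold I k (Function.fixedPoints τ) := by
  intro p hp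
  obtain ⟨φ, hφ, hpφ, -, h⟩ := exists_chart_linearizing_involution hτ hinv hp
  refine ⟨φ, hφ, hpφ, _, hk p hp, fun q hq ↦ ?_⟩
  rw [mem_fixedPoints_iff_of_linearizing h hq]
  rfl

/-- The tangent space of the fixed point set of a smooth involution is the fixed space of the
differential. -/
theorem mem_tangentVectors_fixedPoints_iff {τ : M → M} (hτ : ContMDiff I I ∞ τ)
    (hinv : ∀ q, τ (τ q) = q) {p : M} (hp : τ p = p) (v : E) :
    (v : TangentSpace I p) ∈ tangentVectors I (Function.fixedPoints τ) p ↔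
      modelDeriv I τ p v = v := by
  constructor
  · rintro ⟨γ, hγ, hfix, hv⟩
    have key : modelDeriv I τ (γ 0) (mfderiv 𝓘(ℝ, ℝ) I γ 0 (1 : ℝ)) =
        mfderiv 𝓘(ℝ, ℝ) I γ 0 (1 : ℝ) := by
      have h1 := mfderiv_comp_apply (0 : ℝ) (hτ.mdifferentiable (by simp) (γ 0))
        (hγ.mdifferentiableAt (by simp)) (1 : ℝ)
      have h2 : τ ∘ γ =ᶠ[𝓝 0] γ := hfix.mono fun t ht ↦ ht
      rw [h2.mfderiv_eq] at h1
      exact h1.symm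
    have h3 : ∀ (q : M) (w : TangentSpace I q), (⟨q, w⟩ : TangentBundle I M) = ⟨p, v⟩ →
        modelDeriv I τ q w = w → modelDeriv I τ p v = v := by
      rintro q w h
      cases h
      exact id
    exact h3 _ _ hv key
  · intro hv
    obtain ⟨φ, hφ, hpφ, hφ', h⟩ := exists_chart_linearizing_involution hτ hinv hp
    set ψ := φ.extend I
    have hpψ : p ∈ ψ.source := by rwa [φ.extend_source]
    have hopen : ψ.target ∈ 𝓝 (ψ p) :=
      φ.isOpen_extend_target.mem_nhds (ψ.map_source hpψ)
    have hsymm : ContMDiffAt 𝓘(ℝ, E) I ∞ ψ.symm (ψ p) := by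
      have := contMDiffOn_extend_symm hφ
      refine this.contMDiffAt ?_
      rw [← φ.extend_target']
      exact hopen
    set c : ℝ → E := fun t ↦ ψ p + t • v
    have hc : ContDiff ℝ ∞ c := by fun_prop
    have hc0 : c 0 = ψ p := by simp [c]
    have hsymm' : ContMDiffAt 𝓘(ℝ, E) I ∞ ψ.symm (c 0) := by rwa [hc0]
    refine ⟨ψ.symm ∘ c, hsymm'.comp 0 hc.contMDiff.contMDiffAt, ?_, ?_⟩
    · have : ∀ᶠ t in 𝓝 (0 : ℝ), c t ∈ ψ.target := by
        refine hc.continuous.continuousAt.eventually ?_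
        rwa [hc0]
      filter_upwards [this] with t ht
      have hq := ψ.map_target ht
      rw [φ.extend_source] at hq
      refine (mem_fixedPoints_iff_of_linearizing h hq).2 ?_
      have h1 : φ.extend I (ψ.symm (c t)) = c t := ψ.right_inv ht
      have h2 := (mem_fixedPoints_iff_of_linearizing h hpφ).1 hp
      change modelDeriv I τ p (φ.extend I (ψ.symm (c t))) = φ.extend I (ψ.symm (c t))
      rw [h1]
      simp only [c, map_add, map_smul]
      rw [hv, h2]
    · have h0 : (ψ.symm ∘ c) 0 = p := by
        rw [Function.comp_apply, hc0]
        exact ψ.left_inv hpψ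
      have hψ' : HasMFDerivAt I 𝓘(ℝ, E) ψ (ψ.symm (ψ p)) (ContinuousLinearMap.id ℝ E) := by
        rw [ψ.left_inv hpψ]
        exact hφ'
      have hcomp : mfderiv 𝓘(ℝ, E) 𝓘(ℝ, E) (ψ ∘ ψ.symm) (ψ p) v = v := by
        have : ψ ∘ ψ.symm =ᶠ[𝓝 (ψ p)] id := by
          filter_upwards [hopen] with y hy using ψ.right_inv hy
        rw [this.mfderiv_eq, mfderiv_id]
        rfl
      have hsymm1 : (mfderiv 𝓘(ℝ, E) I ψ.symm (ψ p) v : E) = v := by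
        have h1 := mfderiv_comp_apply (ψ p) hψ'.mdifferentiableAt
          (hsymm.mdifferentiableAt (by simp)) v
        rw [hψ'.mfderiv] at h1
        exact h1.symm.trans hcomp
      have hcd : mfderiv 𝓘(ℝ, ℝ) 𝓘(ℝ, E) c 0 (1 : ℝ) = v := by
        have : HasDerivAt c v 0 := by
          simpa [c] using ((hasDerivAt_id (0 : ℝ)).smul_const v).const_add (ψ p)
        rw [mfderiv_eq_fderiv]
        exact this.deriv
      have hγ := mfderiv_comp_apply (0 : ℝ) (hsymm'.mdifferentiableAt (by simp))
        (hc.contMDiff.mdifferentiableAt (by simp)) (1 : ℝ)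
      have key : ∀ (q : M) (w : TangentSpace I q), q = p → (w : E) = v →
          (⟨q, w⟩ : TangentBundle I M) = ⟨p, v⟩ := by
        rintro q w rfl rfl
        rfl
      refine key _ _ h0 ?_
      have h1 : ∀ y, y = ψ p → (mfderiv 𝓘(ℝ, E) I ψ.symm y v : E) = v := by
        rintro y rfl
        exact hsymm1
      exact hγ.trans ((congrArg _ hcd).trans (h1 _ hc0))

end Linearization

/-! ### Fixed points of isometric involutions -/

section TangentVectors

variable {E : Type*} [NormedAddCommGroup E] [NormedSpace ℝ E]
  {H : Type*} [TopologicalSpace H] {I : ModelWithCorners ℝ E H}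
  {M : Type*} [TopologicalSpace M] [ChartedSpace H M]

/-- Functions which agree on `A` have the same derivative along the vectors tangent to `A`. -/
theorem dirDeriv_congr_of_mem_tangentVectors {A : Set M} {p : M} {v : TangentSpace I p}
    (hv : v ∈ tangentVectors I A p) {f f' : M → ℝ} (hf : MDifferentiableAt I 𝓘(ℝ, ℝ) f p)
    (hf' : MDifferentiableAt I 𝓘(ℝ, ℝ) f' p) (h : ∀ᶠ q in 𝓝 p, q ∈ A → f q = f' q) :
    dirDeriv I f p v = dirDeriv I f' p v := by
  obtain ⟨γ, hγ, hA, hv⟩ := hv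
  have key : ∀ (q : M) (w : TangentSpace I q), (⟨q, w⟩ : TangentBundle I M) = ⟨p, v⟩ → q = p ∧
      ∀ k : M → ℝ, dirDeriv I k q w = dirDeriv I k p v := by
    rintro q w h
    cases h
    exact ⟨rfl, fun _ ↦ rfl⟩
  obtain ⟨h0, hd⟩ := key _ _ hv
  change γ 0 = p at h0
  rw [← hd, ← hd]
  have hev : (fun t ↦ f (γ t)) =ᶠ[𝓝 0] fun t ↦ f' (γ t) := by
    rw [← h0] at h
    filter_upwards [hA, hγ.continuousAt.eventually h] with t h1 h2 using h2 h1
  have hγ' := hγ.mdifferentiableAt (by simp)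
  rw [← h0] at hf hf'
  refine (dirDeriv_comp hf hγ' (1 : ℝ)).symm.trans (Eq.trans ?_ (dirDeriv_comp hf' hγ' (1 : ℝ)))
  exact dirDeriv_congr hev _

end TangentVectors

section KoszulTensorial

variable {E : Type*} [NormedAddCommGroup E] [NormedSpace ℝ E]
  {H : Type*} [TopologicalSpace H] {I : ModelWithCorners ℝ E H}
  {M : Type*} [TopologicalSpace M] [ChartedSpace H M] [IsManifold I ∞ M]
  (g : ContMDiffRiemannianMetric I ∞ E (fun x : M ↦ TangentSpace I x))

theorem isSymmBilinField_inner : IsSymmBilinField I (fun q u v ↦ g.inner q u v) where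
  symm p u v := g.symm p u v
  add_left p u v w := by rw [map_add]; rfl
  smul_left p c u w := by rw [map_smul]; rfl

theorem mdifferentiableAt_inner {X Y : ∀ q : M, TangentSpace I q} {p : M}
    (hX : MDifferentiableAt I I.tangent (fun q ↦ (⟨q, X q⟩ : TangentBundle I M)) p)
    (hY : MDifferentiableAt I I.tangent (fun q ↦ (⟨q, Y q⟩ : TangentBundle I M)) p) :
    MDifferentiableAt I 𝓘(ℝ, ℝ) (fun q ↦ g.inner q (X q) (Y q)) p := by
  have := MDifferentiableAt.clm_bundle_apply₂ (F₁ := E) (F₂ := E) (F₃ := ℝ) (b := fun q : M ↦ q)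
    (E₁ := fun x : M ↦ TangentSpace I x) (E₂ := fun x : M ↦ TangentSpace I x)
    (E₃ := Bundle.Trivial M ℝ) (g.contMDiff.contMDiffAt.mdifferentiableAt (by simp)) hX hY
  simp only [mdifferentiableAt_totalSpace] at this
  exact this.2

/-- The Koszul form as a sum of terms that are tensorial in the last field. -/
theorem koszul_eq_of_last (X Y Z : ∀ q : M, TangentSpace I q) (p : M) :
    koszul I (fun q u v ↦ g.inner q u v) X Y Z p =
      (dirDeriv I (fun q ↦ g.inner q (Y q) (Z q)) p (X p)
        - g.inner p (VectorField.mlieBracket I X Z p) (Y p))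
      + (dirDeriv I (fun q ↦ g.inner q (X q) (Z q)) p (Y p)
        - g.inner p (VectorField.mlieBracket I Y Z p) (X p))
      + (g.inner p (VectorField.mlieBracket I X Y p) (Z p)
        - dirDeriv I (fun q ↦ g.inner q (X q) (Y q)) p (Z p)) := by
  have hh := isSymmBilinField_inner g
  have h1 : (fun q ↦ g.inner q (Z q) (X q)) = fun q ↦ g.inner q (X q) (Z q) :=
    funext fun q ↦ g.symm _ _ _
  have h2 : g.inner p (VectorField.mlieBracket I Z X p) (Y p) =
      -g.inner p (VectorField.mlieBracket I X Z p) (Y p) := by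
    rw [VectorField.mlieBracket_swap_apply (V := Z) (W := X)]
    exact hh.neg_left p _ _
  unfold koszul
  beta_reduce
  rw [h1, h2]
  ring

/-- The Koszul form as a sum of terms that are tensorial in the first field. -/
theorem koszul_eq_of_first (X Y Z : ∀ q : M, TangentSpace I q) (p : M) :
    koszul I (fun q u v ↦ g.inner q u v) X Y Z p =
      (dirDeriv I (fun q ↦ g.inner q (Z q) (X q)) p (Y p)
        - g.inner p (VectorField.mlieBracket I Y X p) (Z p))
      - (dirDeriv I (fun q ↦ g.inner q (Y q) (X q)) p (Z p)
        - g.inner p (VectorField.mlieBracket I Z X p) (Y p))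
      + (dirDeriv I (fun q ↦ g.inner q (Y q) (Z q)) p (X p)
        - g.inner p (VectorField.mlieBracket I Y Z p) (X p)) := by
  have hh := isSymmBilinField_inner g
  have h1 : (fun q ↦ g.inner q (X q) (Y q)) = fun q ↦ g.inner q (Y q) (X q) :=
    funext fun q ↦ g.symm _ _ _
  have h2 : g.inner p (VectorField.mlieBracket I X Y p) (Z p) =
      -g.inner p (VectorField.mlieBracket I Y X p) (Z p) := by
    rw [VectorField.mlieBracket_swap_apply (V := X) (W := Y)]
    exact hh.neg_left p _ _
  unfold koszul
  beta_reduce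
  rw [h1, h2]
  ring

variable [FiniteDimensional ℝ E]

/-- `V ↦ X g(Y, V) - g([X, V], Y)` is tensorial: it is the sum of `g(∇_X Y, V)` and
`g(∇_V X, Y)`. -/
theorem tensorialAt_dirDeriv_sub_mlieBracket {X Y : ∀ q : M, TangentSpace I q} {p : M}
    (hY : SmoothFieldAt I Y p) :
    TensorialAt I E (fun V : (∀ q : M, TangentSpace I q) ↦
      dirDeriv I (fun q ↦ g.inner q (Y q) (V q)) p (X p)
        - g.inner p (VectorField.mlieBracket I X V p) (Y p)) p := by
  have hh := isSymmBilinField_inner g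
  constructor
  · intro f V hf hV
    have h1 : dirDeriv I (fun q ↦ g.inner q (Y q) ((f • V) q)) p (X p) =
        f p * dirDeriv I (fun q ↦ g.inner q (Y q) (V q)) p (X p)
          + g.inner p (Y p) (V p) * dirDeriv I f p (X p) := by
      rw [← dirDeriv_mul hf (mdifferentiableAt_inner g hY.mdifferentiableAt hV)]
      congr 1
      funext q
      exact hh.smul_right q (f q) (Y q) (V q)
    have h2 : g.inner p (VectorField.mlieBracket I X (f • V) p) (Y p) =
        dirDeriv I f p (X p) * g.inner p (V p) (Y p)
          + f p * g.inner p (VectorField.mlieBracket I X V p) (Y p) := by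
      rw [VectorField.mlieBracket_smul_right hf hV]
      exact (hh.add_left p _ _ _).trans
        (congrArg₂ (· + ·) (hh.smul_left p _ _ _) (hh.smul_left p _ _ _))
    rw [h1, h2, g.symm p (V p), smul_eq_mul]
    ring
  · intro V W hV hW
    have h1 : dirDeriv I (fun q ↦ g.inner q (Y q) ((V + W) q)) p (X p) =
        dirDeriv I (fun q ↦ g.inner q (Y q) (V q)) p (X p)
          + dirDeriv I (fun q ↦ g.inner q (Y q) (W q)) p (X p) := by
      rw [← dirDeriv_add (mdifferentiableAt_inner g hY.mdifferentiableAt hV)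
        (mdifferentiableAt_inner g hY.mdifferentiableAt hW)]
      congr 1
      funext q
      exact hh.add_right q (Y q) (V q) (W q)
    have h2 : g.inner p (VectorField.mlieBracket I X (V + W) p) (Y p) =
        g.inner p (VectorField.mlieBracket I X V p) (Y p)
          + g.inner p (VectorField.mlieBracket I X W p) (Y p) := by
      rw [VectorField.mlieBracket_add_right hV hW]
      exact hh.add_left p _ _ _
    rw [h1, h2]
    ring

/-- The Koszul form depends on the value of its last argument at `p` only. -/
theorem koszul_congr_last {X Y Z Z' : ∀ q : M, TangentSpace I q} {p : M}
    (hX : SmoothFieldAt I X p) (hY : SmoothFieldAt I Y p) (hZ : SmoothFieldAt I Z p)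
    (hZ' : SmoothFieldAt I Z' p) (h : Z p = Z' p) :
    koszul I (fun q u v ↦ g.inner q u v) X Y Z p =
      koszul I (fun q u v ↦ g.inner q u v) X Y Z' p := by
  have : IsManifold I 2 M := IsManifold.of_le (n := ∞) (by norm_cast)
  have h1 := (tensorialAt_dirDeriv_sub_mlieBracket g (X := X) hY).pointwise
    hZ.mdifferentiableAt hZ'.mdifferentiableAt h
  have h2 := (tensorialAt_dirDeriv_sub_mlieBracket g (X := Y) hX).pointwise
    hZ.mdifferentiableAt hZ'.mdifferentiableAt h
  rw [koszul_eq_of_last, koszul_eq_of_last, h1, h2, h]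

/-- The Koszul form depends on the value of its first argument at `p` only. -/
theorem koszul_congr_first {X X' Y Z : ∀ q : M, TangentSpace I q} {p : M}
    (hX : SmoothFieldAt I X p) (hX' : SmoothFieldAt I X' p) (hY : SmoothFieldAt I Y p)
    (hZ : SmoothFieldAt I Z p) (h : X p = X' p) :
    koszul I (fun q u v ↦ g.inner q u v) X Y Z p =
      koszul I (fun q u v ↦ g.inner q u v) X' Y Z p := by
  have : IsManifold I 2 M := IsManifold.of_le (n := ∞) (by norm_cast)
  have h1 := (tensorialAt_dirDeriv_sub_mlieBracket g (X := Y) hZ).pointwise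
    hX.mdifferentiableAt hX'.mdifferentiableAt h
  have h2 := (tensorialAt_dirDeriv_sub_mlieBracket g (X := Z) hY).pointwise
    hX.mdifferentiableAt hX'.mdifferentiableAt h
  rw [koszul_eq_of_first, koszul_eq_of_first, h1, h2, h]

/-- The Levi-Civita derivative exists: the Koszul form is a linear form in the value of its last
argument, and `g` is nondegenerate. -/
theorem exists_isLeviCivitaDerivAt {X Y : ∀ q : M, TangentSpace I q} {p : M}
    (hX : SmoothFieldAt I X p) (hY : SmoothFieldAt I Y p) :
    ∃ w, IsLeviCivitaDerivAt I (fun q u v ↦ g.inner q u v) X Y p w := by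
  have : IsManifold I 2 M := IsManifold.of_le (n := ∞) (by norm_cast)
  have h1 := tensorialAt_dirDeriv_sub_mlieBracket g (X := X) hY
  have h2 := tensorialAt_dirDeriv_sub_mlieBracket g (X := Y) hX
  set L : E →L[ℝ] ℝ := TensorialAt.mkHom _ p h1 + TensorialAt.mkHom _ p h2
    + (g.inner p (VectorField.mlieBracket I X Y p)
      - mvfderiv I (fun q ↦ g.inner q (X q) (Y q)) p)
  let G : E →ₗ[ℝ] (E →ₗ[ℝ] ℝ) :=
    (LinearMap.toContinuousLinearMap (𝕜 := ℝ) (E := E) (F' := ℝ)).symm.toLinearMap ∘ₗ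
      (g.inner p : E →L[ℝ] E →L[ℝ] ℝ).toLinearMap
  have hinj : Function.Injective G := by
    rw [injective_iff_map_eq_zero]
    intro u hu
    by_contra hne
    exact (g.pos p u hne).ne' (congrArg (fun A ↦ A u) hu)
  have hsurj := (LinearMap.injective_iff_surjective_of_finrank_eq_finrank
    (Subspace.dual_finrank_eq (K := ℝ) (V := E)).symm).1 hinj
  obtain ⟨w, hw⟩ := hsurj ((1 / 2 : ℝ) • (L : E →ₗ[ℝ] ℝ))
  refine ⟨w, fun Z hZ ↦ ?_⟩
  have h3 : g.inner p w (Z p) = (1 / 2 : ℝ) * L (Z p) := congrArg (fun A ↦ A (Z p)) hw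
  have h4 : L (Z p) = koszul I (fun q u v ↦ g.inner q u v) X Y Z p := by
    rw [koszul_eq_of_last, ← TensorialAt.mkHom_apply h1 hZ.mdifferentiableAt,
      ← TensorialAt.mkHom_apply h2 hZ.mdifferentiableAt]
    rfl
  have h5 : 2 * g.inner p w (Z p) = koszul I (fun q u v ↦ g.inner q u v) X Y Z p := by
    rw [← h4]
    linarith
  exact h5

/-- If `X` is tangent to `A` at `p`, then `∇_X Y` depends on the restriction of `Y` to `A` only. -/
theorem koszul_congr_middle {A : Set M} {X Y Y' Z : ∀ q : M, TangentSpace I q} {p : M}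
    (hX : SmoothFieldAt I X p) (hY : SmoothFieldAt I Y p) (hY' : SmoothFieldAt I Y' p)
    (hZ : SmoothFieldAt I Z p) (hp : p ∈ A) (hXA : X p ∈ tangentVectors I A p)
    (h : ∀ᶠ q in 𝓝 p, q ∈ A → Y q = Y' q) :
    koszul I (fun q u v ↦ g.inner q u v) X Y Z p =
      koszul I (fun q u v ↦ g.inner q u v) X Y' Z p := by
  have hh := isSymmBilinField_inner g
  have h1 := koszul_add_koszul_swap hh X Y Z p
  have h2 := koszul_add_koszul_swap hh X Y' Z p
  have h3 := koszul_congr_last g hX hZ hY hY' (h.self_of_nhds hp)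
  have h4 := dirDeriv_congr_of_mem_tangentVectors hXA
    (mdifferentiableAt_inner g hY.mdifferentiableAt hZ.mdifferentiableAt)
    (mdifferentiableAt_inner g hY'.mdifferentiableAt hZ.mdifferentiableAt)
    (h.mono fun q hq hqA ↦ by rw [hq hqA])
  linarith

variable {g} {σ : M ≃ₘ^∞⟮I, I⟯ M}
  (hσ : ∀ (p : M) (u v : TangentSpace I p),
    g.inner (σ p) (mfderiv I I σ p u) (mfderiv I I σ p v) = g.inner p u v)
include hσ

/-- Isometries preserve the Koszul form. -/
theorem koszul_mpullback {X Y Z : ∀ q : M, TangentSpace I q} {p : M}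
    (hX : SmoothFieldAt I X (σ p)) (hY : SmoothFieldAt I Y (σ p))
    (hZ : SmoothFieldAt I Z (σ p)) :
    koszul I (fun q u v ↦ g.inner q u v) (VectorField.mpullback I I σ X)
        (VectorField.mpullback I I σ Y) (VectorField.mpullback I I σ Z) p =
      koszul I (fun q u v ↦ g.inner q u v) X Y Z (σ p) := by
  have hd : ∀ {U V W : ∀ q : M, TangentSpace I q}, SmoothFieldAt I U (σ p) →
      SmoothFieldAt I V (σ p) → dirDeriv I (fun q ↦ g.inner q (VectorField.mpullback I I σ U q)
        (VectorField.mpullback I I σ V q)) p (VectorField.mpullback I I σ W p) =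
      dirDeriv I (fun q ↦ g.inner q (U q) (V q)) (σ p) (W (σ p)) := by
    intro U V W hU hV
    rw [← σ.mfderiv_mpullback W p, ← dirDeriv_comp
      (mdifferentiableAt_inner g hU.mdifferentiableAt hV.mdifferentiableAt)
      (σ.contMDiff.mdifferentiableAt (by simp))]
    congr 1
    funext q
    rw [← hσ, σ.mfderiv_mpullback, σ.mfderiv_mpullback]
  have hb : ∀ {U V W : ∀ q : M, TangentSpace I q}, SmoothFieldAt I U (σ p) →
      SmoothFieldAt I V (σ p) → g.inner p (VectorField.mlieBracket I
        (VectorField.mpullback I I σ U) (VectorField.mpullback I I σ V) p)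
          (VectorField.mpullback I I σ W p) =
      g.inner (σ p) (VectorField.mlieBracket I U V (σ p)) (W (σ p)) := by
    intro U V W hU hV
    rw [← hσ, σ.mfderiv_mlieBracket_mpullback hU hV, σ.mfderiv_mpullback]
  unfold koszul
  beta_reduce
  rw [hd hY hZ, hd hZ hX, hd hX hY, hb hX hY, hb hY hZ, hb hZ hX]

/-- The fixed point set of an isometric involution `σ` is totally geodesic: for fields `X` and `Y`
tangent to it, `∇_X Y` at a fixed point is invariant under `dσ`. -/
theorem isTotallyGeodesic_fixedPoints [I.Boundaryless] (hinv : ∀ q, σ (σ q) = q) :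
    IsTotallyGeodesic I (fun q u v ↦ g.inner q u v) (Function.fixedPoints σ) := by
  intro p hp X Y hX hY htan
  have hfix : σ p = p := hp
  have hpb : ∀ {U : ∀ q : M, TangentSpace I q} {q : M}, σ q = q →
      U q ∈ tangentVectors I (Function.fixedPoints σ) q →
      VectorField.mpullback I I σ U q = U q := by
    intro U q hq hU
    refine σ.mpullback_apply_mfderiv ?_
    have h1 : (U (σ q) : E) = U q := by rw [hq]
    exact h1.trans ((mem_tangentVectors_fixedPoints_iff σ.contMDiff hinv hq (U q)).1 hU).symm
  have hsm : ∀ {U : ∀ q : M, TangentSpace I q}, SmoothFieldAt I U p →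
      SmoothFieldAt I (VectorField.mpullback I I σ U) p := fun hU ↦
    σ.smoothFieldAt_mpullback (by rwa [hfix])
  obtain ⟨w, hw⟩ := exists_isLeviCivitaDerivAt g hX hY
  refine ⟨w, (mem_tangentVectors_fixedPoints_iff σ.contMDiff hinv hfix w).2 ?_, hw⟩
  have hiso : ∀ u v : E, g.inner p (modelDeriv I σ p u) (modelDeriv I σ p v) = g.inner p u v := by
    intro u v
    have h1 : ∀ q, q = p → ∀ a b : E, g.inner q a b = g.inner p a b := by rintro q rfl a b; rfl
    exact (h1 _ hfix _ _).symm.trans (hσ p u v)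
  have hXp := (htan.self_of_nhds hp).1
  -- `dσ w` and `w` have the same inner products, hence coincide
  have key : ∀ z : E, g.inner p (modelDeriv I σ p w) z = g.inner p w z := by
    intro z
    set Z : ∀ q : M, TangentSpace I q := FiberBundle.extend E (z : TangentSpace I p)
    have hZ : SmoothFieldAt I Z p := smoothFieldAt_extend _
    have hZp : Z p = z := FiberBundle.extend_apply_self _ _
    have h1 : koszul I (fun q u v ↦ g.inner q u v) X Y (VectorField.mpullback I I σ Z) p =
        koszul I (fun q u v ↦ g.inner q u v) X Y Z p := by
      -- `σ^* Y` agrees with `Y` on the fixed point set, and `σ^* X` with `X` at `p`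
      rw [koszul_congr_middle g hX hY (hsm hY) (hsm hZ) hp hXp
          (htan.mono fun q hq hqA ↦ (hpb hqA (hq hqA).2).symm),
        koszul_congr_first g hX (hsm hX) (hsm hY) (hsm hZ) (hpb hfix hXp).symm,
        koszul_mpullback hσ (by rwa [hfix]) (by rwa [hfix]) (by rwa [hfix]), hfix]
    have h2 := hw _ (hsm hZ)
    have h3 := hw _ hZ
    have h4 : modelDeriv I σ p (VectorField.mpullback I I σ Z p) = z := by
      have h5 : (Z (σ p) : E) = z := by rw [hfix]; exact hZp
      exact (σ.mfderiv_mpullback Z p).trans h5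
    have h6 := hiso w (VectorField.mpullback I I σ Z p)
    rw [h4] at h6
    have h7 : g.inner p w (Z p) = g.inner p w z := congrArg _ hZp
    change 2 * g.inner p w (VectorField.mpullback I I σ Z p) =
      koszul I (fun q u v ↦ g.inner q u v) X Y (VectorField.mpullback I I σ Z) p at h2
    change 2 * g.inner p w (Z p) = koszul I (fun q u v ↦ g.inner q u v) X Y Z p at h3
    rw [h7] at h3
    rw [h6]
    linarith
  by_contra hne
  obtain ⟨u, hu⟩ : ∃ u : TangentSpace I p, u = modelDeriv I σ p w := ⟨_, rfl⟩
  rw [← hu] at hne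
  have h8 : ∀ z, g.inner p u z = g.inner p w z := fun z ↦ by rw [hu]; exact key z
  refine (g.pos p (u - w) (sub_ne_zero.2 hne)).ne' ?_
  exact ((isSymmBilinField_inner g).sub_left p _ _ _).trans (sub_eq_zero.2 (h8 _))

end KoszulTensorial

/-! ### Involutions anticommuting with a complex structure -/

section LinearAlgebra

/-- A complex structure which anticommutes with an involution exchanges its two eigenspaces, so
that these have half the dimension. -/
theorem two_mul_finrank_eqLocus_of_anticommute {V : Type*} [AddCommGroup V] [Module ℝ V]
    [FiniteDimensional ℝ V] {A J : V →ₗ[ℝ] V} (hA : ∀ v, A (A v) = v) (hJ : ∀ v, J (J v) = -v)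
    (hAJ : ∀ v, A (J v) = -J (A v)) :
    2 * Module.finrank ℝ (LinearMap.eqLocus A LinearMap.id) = Module.finrank ℝ V := by
  set K := LinearMap.eqLocus A LinearMap.id
  have hK : LinearMap.ker (A - LinearMap.id) = K := by
    ext v
    simp [K, sub_eq_zero]
  -- the range of `A - 1` is the eigenspace for `-1`
  have hrange : LinearMap.range (A - LinearMap.id) = K.map J := by
    ext v
    simp only [LinearMap.mem_range, Submodule.mem_map, K, LinearMap.mem_eqLocus,
      LinearMap.sub_apply, LinearMap.id_apply]
    constructor
    · rintro ⟨w, rfl⟩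
      refine ⟨-J (A w - w), ?_, ?_⟩
      · rw [map_neg, hAJ, map_sub, hA, ← map_neg, ← map_neg]
        simp
      · rw [map_neg, hJ, neg_neg]
    · rintro ⟨k, hk, rfl⟩
      refine ⟨-(1 / 2 : ℝ) • J k, ?_⟩
      rw [map_smul, hAJ, hk]
      module
  have hJinj : Function.Injective J := fun u v h ↦ by
    have := congrArg J h
    rwa [hJ, hJ, neg_inj] at this
  have h1 := LinearMap.finrank_range_add_finrank_ker (A - LinearMap.id)
  rw [hK, hrange, ← (K.equivMapOfInjective J hJinj).finrank_eq] at h1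
  linarith

end LinearAlgebra

/-! ### The induced map of the link -/

section Link

/-- The map of `S` induced by a map of the cone, through the hypersurface `r = 1`. -/
def linkMap {S : Type*} (τ : Cone S → Cone S) (x : S) : S := (τ (unitSection x)).2

variable {n : ℕ} {S : Type*} [TopologicalSpace S]
  [ChartedSpace (EuclideanSpace ℝ (Fin (2 * n + 1))) S]

theorem contMDiff_unitSection :
    ContMDiff (baseModel n) (coneModel n) ∞ (unitSection : S → Cone S) :=
  contMDiff_const.prodMk contMDiff_id

theorem mfderiv_unitSection (x : S) (v : EuclideanSpace ℝ (Fin (2 * n + 1))) :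
    (mfderiv (baseModel n) (coneModel n) (unitSection : S → Cone S) x v :
      ℝ × EuclideanSpace ℝ (Fin (2 * n + 1))) = (0, v) := by
  have h := (hasMFDerivAt_const (I := baseModel n) (I' := 𝓘(ℝ, ℝ))
    (⟨1, show (0 : ℝ) < 1 from one_pos⟩ : posReal) x).prodMk (hasMFDerivAt_id (I := baseModel n) x)
  have h' : mfderiv (baseModel n) (coneModel n) (unitSection : S → Cone S) x = _ := h.mfderiv
  rw [h']
  rfl

theorem contMDiff_linkMap {τ : Cone S → Cone S} (hτ : ContMDiff (coneModel n) (coneModel n) ∞ τ) :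
    ContMDiff (baseModel n) (baseModel n) ∞ (linkMap τ) :=
  contMDiff_snd.comp (hτ.comp contMDiff_unitSection)

/-- The map of `S` induced by a diffeomorphism `τ` of the cone, as a diffeomorphism when it is an
involution. -/
def linkDiffeomorph (τ : Cone S ≃ₘ^∞⟮coneModel n, coneModel n⟯ Cone S)
    (h : ∀ x, linkMap τ (linkMap τ x) = x) : S ≃ₘ^∞⟮baseModel n, baseModel n⟯ S where
  toFun := linkMap τ
  invFun := linkMap τ
  left_inv := h
  right_inv := h
  contMDiff_toFun := contMDiff_linkMap τ.contMDiff
  contMDiff_invFun := contMDiff_linkMap τ.contMDiff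

variable {τ : Cone S ≃ₘ^∞⟮coneModel n, coneModel n⟯ Cone S}
  (hprod : ∀ p : Cone S, τ p = (p.1, linkMap τ p.2))
include hprod

theorem modelDeriv_of_forall_eq_prod (p : Cone S) (v : ℝ × EuclideanSpace ℝ (Fin (2 * n + 1))) :
    modelDeriv (coneModel n) τ p v = (v.1, modelDeriv (baseModel n) (linkMap τ) p.2 v.2) := by
  have h1 : (τ : Cone S → Cone S) = Prod.map id (linkMap τ) := funext hprod
  have h2 := mfderiv_prodMap (p := p) (f := (id : posReal → posReal)) (g := linkMap τ)
    (I := 𝓘(ℝ, ℝ)) (I' := baseModel n) (J := 𝓘(ℝ, ℝ)) (J' := baseModel n) mdifferentiableAt_id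
    ((contMDiff_linkMap τ.contMDiff).mdifferentiableAt (by simp))
  rw [mfderiv_id, ← h1] at h2
  exact congrArg (fun L ↦ L v) h2

theorem linkMap_linkMap (hinv : ∀ p, τ (τ p) = p) (x : S) : linkMap τ (linkMap τ x) = x := by
  have h1 : unitSection (linkMap τ x) = τ (unitSection x) := (hprod (unitSection x)).symm
  have h2 : (τ (unitSection (linkMap τ x))).2 = x := by rw [h1, hinv]; rfl
  exact h2

theorem mem_fixedPoints_iff_snd (p : Cone S) :
    p ∈ Function.fixedPoints τ ↔ p.2 ∈ Function.fixedPoints (linkMap τ) := by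
  rw [Function.mem_fixedPoints, Function.IsFixedPt, hprod]
  exact ⟨fun h ↦ (Prod.ext_iff.1 h).2, fun h ↦ Prod.ext rfl h⟩

theorem link_fixedPoints :
    link (Function.fixedPoints τ) = Function.fixedPoints (linkMap τ) := by
  ext x
  exact mem_fixedPoints_iff_snd hprod (unitSection x)

theorem isCone_fixedPoints : IsCone (Function.fixedPoints τ) := fun a ha p hp ↦
  (mem_fixedPoints_iff_snd hprod (dilation a ha p)).2 ((mem_fixedPoints_iff_snd hprod p).1 hp)

/-- When `τ` is a product, its differential fixes the radial direction, which adds `1` to the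
dimension of the fixed space. -/
theorem finrank_eqLocus_modelDeriv (p : Cone S) :
    Module.finrank ℝ (LinearMap.eqLocus
        (modelDeriv (coneModel n) τ p : ℝ × EuclideanSpace ℝ (Fin (2 * n + 1)) →ₗ[ℝ] _)
          LinearMap.id) =
      1 + Module.finrank ℝ (LinearMap.eqLocus
        (modelDeriv (baseModel n) (linkMap τ) p.2 : EuclideanSpace ℝ (Fin (2 * n + 1)) →ₗ[ℝ] _)
          LinearMap.id) := by
  set K := LinearMap.eqLocus
    (modelDeriv (baseModel n) (linkMap τ) p.2 : EuclideanSpace ℝ (Fin (2 * n + 1)) →ₗ[ℝ] _)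
      LinearMap.id
  have h1 : LinearMap.eqLocus
      (modelDeriv (coneModel n) τ p : ℝ × EuclideanSpace ℝ (Fin (2 * n + 1)) →ₗ[ℝ] _)
        LinearMap.id = (⊤ : Submodule ℝ ℝ).prod K := by
    ext v
    have h2 := modelDeriv_of_forall_eq_prod hprod p v
    simp only [LinearMap.mem_eqLocus, ContinuousLinearMap.coe_coe, LinearMap.id_apply,
      Submodule.mem_prod, Submodule.mem_top, true_and, K]
    rw [h2]
    exact ⟨fun h ↦ congrArg Prod.snd h, fun h ↦ Prod.ext rfl h⟩
  let e : (⊤ : Submodule ℝ ℝ).prod K ≃ₗ[ℝ] ℝ × K :=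
    { toFun := fun v ↦ (v.1.1, ⟨v.1.2, v.2.2⟩)
      invFun := fun w ↦ ⟨(w.1, w.2), trivial, w.2.2⟩
      map_add' := fun _ _ ↦ rfl
      map_smul' := fun _ _ ↦ rfl }
  rw [h1, e.finrank_eq, Module.finrank_prod, Module.finrank_self]

end Link

/-! ### The fixed point set and its link -/

section FixedSpace

variable {n : ℕ} {S : Type*} [TopologicalSpace S]
  [ChartedSpace (EuclideanSpace ℝ (Fin (2 * n + 1))) S] [IsManifold (baseModel n) ∞ S]

/-- At a fixed point, the fixed space of `dτ` has half the dimension of the cone. -/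
theorem finrank_eqLocus_of_fixed
    {J : ∀ p : Cone S, TangentSpace (coneModel n) p →L[ℝ] TangentSpace (coneModel n) p}
    (hJ : IsComplexStructure (coneModel n) J) {τ : Cone S ≃ₘ^∞⟮coneModel n, coneModel n⟯ Cone S}
    (hτ : IsAntiholomorphicInvolution (coneModel n) J τ) {p : Cone S} (hp : τ p = p) :
    Module.finrank ℝ (LinearMap.eqLocus
        (modelDeriv (coneModel n) τ p : ℝ × EuclideanSpace ℝ (Fin (2 * n + 1)) →ₗ[ℝ] _)
          LinearMap.id) = n + 1 := by
  let J' : ℝ × EuclideanSpace ℝ (Fin (2 * n + 1)) →L[ℝ] ℝ × EuclideanSpace ℝ (Fin (2 * n + 1)) :=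
    J p
  have hJ' : ∀ q, q = p → ∀ v : ℝ × EuclideanSpace ℝ (Fin (2 * n + 1)), J q v = J' v := by
    rintro q rfl v; rfl
  have h := two_mul_finrank_eqLocus_of_anticommute
    (A := (modelDeriv (coneModel n) τ p : ℝ × EuclideanSpace ℝ (Fin (2 * n + 1)) →ₗ[ℝ] _))
    (J := J') (modelDeriv_modelDeriv (τ.contMDiff.mdifferentiable (by simp)) hτ.involutive hp)
    (hJ.sq_eq_neg p)
    (fun v ↦ (hτ.antiholomorphic p v).trans (congrArg Neg.neg (hJ' _ hp _)))
  have h2 : Module.finrank ℝ (ℝ × EuclideanSpace ℝ (Fin (2 * n + 1))) = 2 * (n + 1) := by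
    rw [Module.finrank_prod, Module.finrank_self, finrank_euclideanSpace_fin]
    ring
  rw [h2] at h
  exact Nat.eq_of_mul_eq_mul_left two_pos h

end FixedSpace

section Assembly

variable {n : ℕ} {S : Type*} [TopologicalSpace S]
  [ChartedSpace (EuclideanSpace ℝ (Fin (2 * n + 1))) S] [IsManifold (baseModel n) ∞ S]
  (g : ContMDiffRiemannianMetric (baseModel n) ∞ (EuclideanSpace ℝ (Fin (2 * n + 1)))
      (fun x : S ↦ TangentSpace (baseModel n) x))
  {J : ∀ p : Cone S, TangentSpace (coneModel n) p →L[ℝ] TangentSpace (coneModel n) p}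
  (hJ : IsSasaki g J)
  {τ : Cone S ≃ₘ^∞⟮coneModel n, coneModel n⟯ Cone S}
  (hτ : IsAntiholomorphicInvolution (coneModel n) J τ) (hr : ∀ p : Cone S, radius (τ p) = radius p)
include hJ hτ hr

/-- The Kähler form vanishes on the fixed vectors of `dτ`, since `τ^* ω = -ω`. -/
theorem isLagrangian_fixedPoints :
    IsLagrangian (coneModel n) (coneMetric g) J (Function.fixedPoints τ) := by
  refine ⟨⟨n + 1, ?_, isSubmanifold_fixedPoints τ.contMDiff hτ.involutive fun p hp ↦
    finrank_eqLocus_of_fixed hJ.complex hτ hp⟩, ?_⟩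
  · rw [Module.finrank_prod, Module.finrank_self, finrank_euclideanSpace_fin]
    ring
  · intro p hp u hu v hv
    have hu' := (mem_tangentVectors_fixedPoints_iff τ.contMDiff hτ.involutive hp u).1 hu
    have hv' := (mem_tangentVectors_fixedPoints_iff τ.contMDiff hτ.involutive hp v).1 hv
    have key : ∀ q, q = p → ∀ a b : ℝ × EuclideanSpace ℝ (Fin (2 * n + 1)), a = u → b = v →
        fundamentalForm (coneModel n) (coneMetric g) J q a b =
          fundamentalForm (coneModel n) (coneMetric g) J p u v := by
      rintro q rfl a b rfl rfl; rfl
    have h1 := fundamentalForm_mfderiv g hJ hτ hr p u v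
    have h2 := (key _ hp _ _ hu' hv').symm.trans h1
    linarith

variable [T2Space S]

/-- `τ` is the product of the identity and of the induced map of `S`, because it commutes with the
dilations. -/
theorem apply_eq_prod_linkMap (p : Cone S) : τ p = (p.1, linkMap τ p.2) := by
  -- every point lies on the ray of a point at radius `1`
  have hp : p = ray (unitSection p.2) (Real.log p.1) := by
    refine Prod.ext (Subtype.ext ?_) rfl
    change (p.1 : ℝ) = Real.exp (Real.log p.1) * 1
    rw [Real.exp_log p.1.2, mul_one]
  refine Prod.ext (Subtype.ext (hr p)) ?_
  have h := map_ray g hJ hτ hr (unitSection p.2) (Real.log p.1)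
  rw [← hp] at h
  exact (Prod.ext_iff.1 h).2

/-- The induced map of `S` is an isometry: it is the restriction of the isometry `τ` of the cone to
the hypersurface `r = 1`. -/
theorem inner_mfderiv_linkMap (x : S) (u v : TangentSpace (baseModel n) x) :
    g.inner (linkMap τ x) (mfderiv (baseModel n) (baseModel n) (linkMap τ) x u)
      (mfderiv (baseModel n) (baseModel n) (linkMap τ) x v) = g.inner x u v := by
  have hprod := apply_eq_prod_linkMap g hJ hτ hr
  have hd : ∀ w : EuclideanSpace ℝ (Fin (2 * n + 1)),
      modelDeriv (coneModel n) τ (unitSection x) (0, w) =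
        (0, modelDeriv (baseModel n) (linkMap τ) x w) := fun w ↦
    modelDeriv_of_forall_eq_prod hprod (unitSection x) (0, w)
  have h := coneMetric_mfderiv g hJ hτ hr (unitSection x)
    ((0 : ℝ), (u : EuclideanSpace ℝ (Fin (2 * n + 1))))
    ((0 : ℝ), (v : EuclideanSpace ℝ (Fin (2 * n + 1))))
  have h1 := (coneMetric_apply_eq g _ _ _).symm.trans (h.trans (coneMetric_apply_eq g _ _ _))
  rw [hr] at h1
  have key : ∀ (r : ℝ) (a b : ℝ × EuclideanSpace ℝ (Fin (2 * n + 1))),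
      a = (0, modelDeriv (baseModel n) (linkMap τ) x u) →
      b = (0, modelDeriv (baseModel n) (linkMap τ) x v) →
      a.1 * b.1 + r ^ 2 * g.inner (linkMap τ x) a.2 b.2 =
        0 * 0 + r ^ 2 * g.inner (linkMap τ x)
          (mfderiv (baseModel n) (baseModel n) (linkMap τ) x u)
          (mfderiv (baseModel n) (baseModel n) (linkMap τ) x v) := by
    rintro r a b rfl rfl
    rfl
  have h2 : 0 * 0 + (1 : ℝ) ^ 2 * g.inner (linkMap τ x)
      (mfderiv (baseModel n) (baseModel n) (linkMap τ) x u)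
      (mfderiv (baseModel n) (baseModel n) (linkMap τ) x v) =
      0 * 0 + (1 : ℝ) ^ 2 * g.inner x u v :=
    (key _ _ _ (hd u) (hd v)).symm.trans h1
  linarith

/-- The contact form vanishes on vectors tangent to the link, since `τ^* θ = -θ` while `dτ` fixes
these vectors. -/
theorem isLegendrian_link : IsLegendrian g J (link (Function.fixedPoints τ)) := by
  have hprod := apply_eq_prod_linkMap g hJ hτ hr
  have hinv := linkMap_linkMap hprod hτ.involutive
  have hσ := contMDiff_linkMap τ.contMDiff
  rw [link_fixedPoints hprod]
  refine ⟨isSubmanifold_fixedPoints hσ hinv fun x hx ↦ ?_, fun x hx v hv ↦ ?_⟩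
  · have h1 := finrank_eqLocus_of_fixed hJ.complex hτ (p := unitSection x)
      ((mem_fixedPoints_iff_snd hprod _).2 hx)
    rw [finrank_eqLocus_modelDeriv hprod, add_comm] at h1
    exact Nat.add_right_cancel h1
  · have hp : τ (unitSection x) = unitSection x := (mem_fixedPoints_iff_snd hprod _).2 hx
    have hv' := (mem_tangentVectors_fixedPoints_iff hσ hinv hx v).1 hv
    set w := mfderiv (baseModel n) (coneModel n) (unitSection : S → Cone S) x v
    have hw : (w : ℝ × EuclideanSpace ℝ (Fin (2 * n + 1))) = (0, v) := mfderiv_unitSection x v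
    have hw' : modelDeriv (coneModel n) τ (unitSection x) w = w := by
      refine (modelDeriv_of_forall_eq_prod hprod (unitSection x) w).trans (Prod.ext rfl ?_)
      have h2 : (w : ℝ × EuclideanSpace ℝ (Fin (2 * n + 1))).2 = v := congrArg Prod.snd hw
      exact (congrArg _ h2).trans (hv'.trans h2.symm)
    have key : ∀ q, q = unitSection x → ∀ a : ℝ × EuclideanSpace ℝ (Fin (2 * n + 1)), a = w →
        coneMetric g q (J q (eulerField q)) a =
          coneMetric g (unitSection x) (J (unitSection x) (eulerField (unitSection x))) w := by
      rintro q rfl a rfl; rfl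
    have h1 := (key _ hp _ hw').symm.trans (reebForm_mfderiv g hJ hτ hr (unitSection x) w)
    have h3 : coneMetric g (unitSection x) (J (unitSection x) (eulerField (unitSection x))) w = 0 :=
      by linarith
    unfold contactForm coneContactForm
    rw [h3, mul_zero]

end Assembly

end

theorem mainTheorem6 (n : ℕ) (S : Type*) [TopologicalSpace S] [T2Space S]
    [SecondCountableTopology S] [ChartedSpace (EuclideanSpace ℝ (Fin (2 * n + 1))) S]
    [IsManifold (baseModel n) ∞ S]
    (g : ContMDiffRiemannianMetric (baseModel n) ∞ (EuclideanSpace ℝ (Fin (2 * n + 1)))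
      (fun x : S ↦ TangentSpace (baseModel n) x))
    (J : ∀ p : Cone S, TangentSpace (coneModel n) p →L[ℝ] TangentSpace (coneModel n) p)
    (hJ : IsSasaki g J)
    (τ : Cone S ≃ₘ^∞⟮coneModel n, coneModel n⟯ Cone S)
    (hτ : IsAntiholomorphicInvolution (coneModel n) J τ)
    (hr : ∀ p : Cone S, radius (τ p) = radius p)
    (hfix : (Function.fixedPoints τ).Nonempty) :
    (IsLagrangian (coneModel n) (coneMetric g) J (Function.fixedPoints τ) ∧
      IsCone (Function.fixedPoints τ)) ∧
    (link (Function.fixedPoints τ)).Nonempty ∧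
    IsLegendrian g J (link (Function.fixedPoints τ)) ∧
    IsTotallyGeodesic (baseModel n) (fun x u v ↦ g.inner x u v)
      (link (Function.fixedPoints τ)) := by
  have hprod := apply_eq_prod_linkMap g hJ hτ hr
  have hinv := linkMap_linkMap hprod hτ.involutive
  refine ⟨⟨isLagrangian_fixedPoints g hJ hτ hr, isCone_fixedPoints hprod⟩, ?_,
    isLegendrian_link g hJ hτ hr, ?_⟩
  · obtain ⟨p, hp⟩ := hfix
    rw [link_fixedPoints hprod]
    exact ⟨p.2, (mem_fixedPoints_iff_snd hprod p).1 hp⟩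
  · rw [link_fixedPoints hprod]
    exact isTotallyGeodesic_fixedPoints (σ := linkDiffeomorph τ hinv)
      (inner_mfderiv_linkMap g hJ hτ hr) hinv
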